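/- A subset of $\mathbb{R}^m$ is called \emph{semialgebraic} if it is a finite union of sets of the form $\{x\in\mathbb{R}^m : f(x)=0,\ g_1(x)>0,\dots,g_\ell(x)>0\}$ with $f,g_1,\dots,g_\ell$ real polynomials. A \emph{semialgebraic map} $\pi:M\to N$ between semialgebraic sets $M\subset\mathbb{R}^m$ and $N\subset\mathbb{R}^n$ is a continuous map whose graph is a semialgebraic subset of $\mathbb{R}^{m+n}$. It is \emph{locally injective} if $M$ is covered by a family of open semialgebraic subsets of $M$ on each of which $\pi$ is injective. Let $\mathcal{S}(M)$ denote the $\mathbb{R}$-algebra, under pointwise operations, of continuous functions $M\to\mathbb{R}$ with semialgebraic graph. A semialgebraic map $\pi:M\to N$ induces the homomorphism $\varphi_\pi:\mathcal{S}(N)\to\mathcal{S}(M)$, $g\mapsto g\circ\pi$; it is called \emph{finite} if there are finitely many $b_1,\dots,b_r\in\mathcal{S}(M)$ with $\mathcal{S}(M)=\varphi_\pi(\mathcal{S}(N))\,b_1+\cdots+\varphi_\pi(\mathcal{S}(N))\,b_r$. \textbf{Corollary.} Let $M\subset\mathbb{R}^m$ and $N\subset\mathbb{R}^n$ be compact semialgebraic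 sets and let $\pi:M\to N$ be a semialgebraic map. Then $\pi$ is locally injective if and only if $\varphi_\pi:\mathcal{S}(N)\to\mathcal{S}(M)$ is a finite homomorphism. -/

import Mathlib

namespace Semialg

/-! ## Semialgebraic sets

Throughout, `ℝ^m` is modelled as `Fin m → ℝ`, more generally `ℝ^σ` as `σ → ℝ` for an index type `σ`;
for finite `σ` the product topology is the Euclidean topology. -/

open MvPolynomial in
/-- A basic semialgebraic subset of `ℝ^σ`: the solution set of one polynomial equation and finitely
many strict polynomial inequalities. -/
def IsBasicSemialgebraic {σ : Type*} (S : Set (σ → ℝ)) : Prop :=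
  ∃ (f : MvPolynomial σ ℝ) (G : Finset (MvPolynomial σ ℝ)),
    S = {x | eval x f = 0 ∧ ∀ g ∈ G, 0 < eval x g}

/-- A semialgebraic subset of `ℝ^σ`: a finite union of basic semialgebraic sets. -/
def IsSemialgebraic {σ : Type*} (S : Set (σ → ℝ)) : Prop :=
  ∃ 𝓑 : Set (Set (σ → ℝ)), 𝓑.Finite ∧ (∀ B ∈ 𝓑, IsBasicSemialgebraic B) ∧ S = ⋃₀ 𝓑

/-! ## Projections of semialgebraic sets

The Tarski-Seidenberg theorem is proved here because it is what makes the semialgebraic functions on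
a set a ring, and composition with a semialgebraic map a ring homomorphism. The quantifier over the
line is eliminated by matching the sign behaviour of two families of real polynomials along a finite
partial order isomorphism of the line. -/

theorem poly_sign_mvt (p : Polynomial ℝ) {u v : ℝ} {ε : SignType}
    (h : ∀ w ∈ Set.uIcc u v, SignType.sign (p.derivative.eval w) = ε) :
    SignType.sign (p.eval v - p.eval u) = ε * SignType.sign (v - u) := by
  rcases lt_trichotomy u v with huv | rfl | huv
  · obtain ⟨w, hw, e⟩ := exists_hasDerivAt_eq_slope (fun x => p.eval x)
      (fun x => p.derivative.eval x) huv p.continuous.continuousOn (fun x _ => p.hasDerivAt x)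
    rw [← h w (by rw [Set.uIcc_of_le huv.le]; exact ⟨hw.1.le, hw.2.le⟩), ← sign_mul, e,
      div_mul_cancel₀ _ (sub_ne_zero.2 huv.ne')]
  · simp
  · obtain ⟨w, hw, e⟩ := exists_hasDerivAt_eq_slope (fun x => p.eval x)
      (fun x => p.derivative.eval x) huv p.continuous.continuousOn (fun x _ => p.hasDerivAt x)
    rw [← h w (by rw [Set.uIcc_of_ge huv.le]; exact ⟨hw.1.le, hw.2.le⟩), ← sign_mul, e]
    congr 1
    have : u - v ≠ 0 := sub_ne_zero.2 huv.ne'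
    field_simp
    ring

/-- `t` lies in the same position relative to the first coordinates of `F` as `s` does relative to
the second coordinates. -/
def SamePos (F : Set (ℝ × ℝ)) (t s : ℝ) : Prop :=
  ∀ z ∈ F, (z.1 < t ↔ z.2 < s) ∧ (t < z.1 ↔ s < z.2)

/-- A finite partial order isomorphism of the real line, given by its graph. -/
def IsPartialIso (F : Set (ℝ × ℝ)) : Prop :=
  F.Finite ∧ ∀ z ∈ F, SamePos F z.1 z.2

theorem SamePos.swap {F : Set (ℝ × ℝ)} {t s : ℝ} (h : SamePos F t s) :
    SamePos (Prod.swap ⁻¹' F) s t :=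
  fun _ hz => ⟨(h _ hz).1.symm, (h _ hz).2.symm⟩

theorem IsPartialIso.swap {F : Set (ℝ × ℝ)} (h : IsPartialIso F) :
    IsPartialIso (Prod.swap ⁻¹' F) :=
  ⟨h.1.preimage Prod.swap_injective.injOn, fun _ hz => (h.2 _ hz).swap⟩

theorem IsPartialIso.across {F : Set (ℝ × ℝ)} (h : IsPartialIso F) (t : ℝ) :
    ∃ s, SamePos F t s := by
  classical
  have key : ∀ z w : ℝ × ℝ, ((z.1 < w.1 ↔ z.2 < w.2) ∧ (w.1 < z.1 ↔ w.2 < z.2)) ↔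
      cmp z.1 w.1 = cmp z.2 w.2 := by
    intro z w
    rcases lt_trichotomy z.1 w.1 with a | a | a <;> rcases lt_trichotomy z.2 w.2 with b | b | b <;>
      simp [cmp, cmpUsing, a, b, not_lt_of_gt]
  obtain ⟨s, hs⟩ := Order.PartialIso.exists_across (α := ℝ) (β := ℝ)
    ⟨h.1.toFinset, fun z hz w hw => (key z w).1 (by
      rw [Set.Finite.mem_toFinset] at hz hw
      exact h.2 w hw z hz)⟩ t
  refine ⟨s, fun z hz => (key z (t, s)).2 (hs z (by simpa using hz))⟩

theorem SamePos.convex {F : Set (ℝ × ℝ)} {t t' s u : ℝ} (h : SamePos F t s) (h' : SamePos F t' s)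
    (hu : u ∈ Set.uIcc t t') : SamePos F u s := by
  intro z hz
  have := h z hz
  have := h' z hz
  rw [Set.mem_uIcc] at hu
  grind

/-- Sign agreement of two polynomials along `F`. -/
def SignMatch (F : Set (ℝ × ℝ)) (p q : Polynomial ℝ) : Prop :=
  ∀ t s, SamePos F t s → SignType.sign (p.eval t) = SignType.sign (q.eval s)

theorem SignMatch.swap {F : Set (ℝ × ℝ)} {p q : Polynomial ℝ} (h : SignMatch F p q) :
    SignMatch (Prod.swap ⁻¹' F) q p :=
  fun _ _ hts => (h _ _ hts.swap).symm

theorem SignMatch.mem_of_root {F : Set (ℝ × ℝ)} (hF : IsPartialIso F) {p q : Polynomial ℝ}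
    (h : SignMatch F p q) (hp : p ≠ 0) {t s : ℝ} (hts : SamePos F t s) (ht : p.eval t = 0) :
    (t, s) ∈ F := by
  by_contra hn
  have hne : ∀ z ∈ F, z.1 ≠ t := by
    rintro z hz rfl
    have := hts z hz
    have : z.2 = s := by grind
    exact hn (by rw [← this]; exact hz)
  apply hp
  apply Polynomial.eq_zero_of_infinite_isRoot
  refine infinite_of_mem_nhds t ?_
  have : ∀ᶠ u in nhds t, ∀ z ∈ F, (z.1 < u ↔ z.1 < t) ∧ (u < z.1 ↔ t < z.1) := by
    rw [Filter.eventually_all_finite hF.1]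
    intro z hz
    rcases lt_or_gt_of_ne (hne z hz) with hl | hl
    · filter_upwards [eventually_gt_nhds hl] with u hu
      grind
    · filter_upwards [eventually_lt_nhds hl] with u hu
      grind
  filter_upwards [this] with u hu
  have hus : SamePos F u s := fun z hz =>
    ⟨(hu z hz).1.trans (hts z hz).1, (hu z hz).2.trans (hts z hz).2⟩
  have e := (h u s hus).trans (h t s hts).symm
  rw [ht, sign_zero, sign_eq_zero_iff] at e
  exact e

theorem exists_root_left {F : Set (ℝ × ℝ)} (hF : IsPartialIso F) {p q : Polynomial ℝ}
    (hd : SignMatch F p.derivative q.derivative)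
    (hpq : ∀ z ∈ F, SignType.sign (p.eval z.1) = SignType.sign (q.eval z.2))
    {t s : ℝ} (hts : SamePos F t s) (ht' : 0 < p.derivative.eval t)
    (ht : 0 < p.eval t) (hs : q.eval s ≤ 0) : ∃ c, SamePos F c s ∧ p.eval c = 0 := by
  by_contra! hno
  have hne : ∀ z ∈ F, z.1 ≠ t := by
    rintro z hz rfl
    have h1 := hts z hz
    have : z.2 = s := by grind
    have h2 := hpq z hz
    rw [this, sign_pos ht] at h2
    exact absurd (sign_eq_one_iff.1 h2.symm) (not_lt.2 hs)
  have hpos : ∀ u ≤ t, SamePos F u s → 0 < p.eval u := by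
    intro u hut hu
    by_contra! h0
    obtain ⟨c, hc, hc0⟩ := intermediate_value_Icc hut p.continuous.continuousOn ⟨h0, ht.le⟩
    exact hno c (hu.convex hts (by rwa [Set.uIcc_of_le hut])) hc0
  by_cases hex : ∃ z ∈ F, z.1 < t
  · obtain ⟨a, ⟨haF, hat⟩, hmax⟩ := Set.exists_max_image {z ∈ F | z.1 < t} Prod.fst
      (hF.1.subset (Set.sep_subset _ _)) hex
    have hmax' : ∀ y ∈ F, y.1 < t → y.1 ≤ a.1 := fun y hy h => hmax y ⟨hy, h⟩
    have hgap : ∀ u, a.1 < u → u ≤ t → SamePos F u s := by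
      intro u h1 h2 y hy
      have := hts y hy
      have := hmax' y hy
      have := hne y hy
      grind
    have hgap' : ∀ v, a.2 < v → v ≤ s → SamePos F t v := by
      intro u h1 h2 y hy
      have := hts y hy
      have := hmax' y hy
      have := hne y hy
      have := hF.2 a haF y hy
      grind
    have has : a.2 < s := (hts a haF).1.1 hat
    have hpa : 0 ≤ p.eval a.1 := by
      refine ge_of_tendsto (x := nhdsWithin a.1 (Set.Ioi a.1))
        (p.continuous.continuousAt.tendsto.mono_left nhdsWithin_le_nhds) ?_
      filter_upwards [Ioc_mem_nhdsGT hat] with u hu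
      exact (hpos u hu.2 (hgap u hu.1 hu.2)).le
    have hqa : 0 ≤ q.eval a.2 := by
      rw [← sign_nonneg_iff, ← hpq a haF, sign_nonneg_iff]
      exact hpa
    have hmono : StrictMonoOn (fun x => q.eval x) (Set.Icc a.2 s) := by
      refine strictMonoOn_of_deriv_pos (convex_Icc _ _) q.continuous.continuousOn ?_
      intro v hv
      rw [interior_Icc] at hv
      rw [Polynomial.deriv, ← sign_eq_one_iff, ← hd t v (hgap' v hv.1 hv.2.le), sign_pos ht']
    have := hmono ⟨le_rfl, has.le⟩ ⟨has.le, le_rfl⟩ has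
    simp only at this
    linarith
  · push Not at hex
    have hgap : ∀ u ≤ t, SamePos F u s := by
      intro u h y hy
      have := hex y hy
      have := hne y hy
      have := hts y hy
      grind
    have hdeg : 0 < p.degree := by
      by_contra! h
      rw [Polynomial.eq_C_of_degree_le_zero h] at ht'
      simp at ht'
    have hlim : Filter.Tendsto (fun x : ℝ => ‖p.eval x‖) Filter.atBot Filter.atTop :=
      p.tendsto_norm_atTop hdeg (z := fun x => x) (by
        simpa [Real.norm_eq_abs] using Filter.tendsto_abs_atBot_atTop)
    have hmono : MonotoneOn (fun x => p.eval x) (Set.Iic t) := by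
      refine monotoneOn_of_deriv_nonneg (convex_Iic _) p.continuous.continuousOn
        p.differentiable.differentiableOn ?_
      intro v hv
      rw [interior_Iic] at hv
      rw [Polynomial.deriv, ← sign_nonneg_iff, hd v s (hgap v (le_of_lt hv)), ← hd t s hts,
        sign_nonneg_iff]
      exact ht'.le
    obtain ⟨u, h1, h2⟩ := ((hlim.eventually_gt_atTop (p.eval t)).and
      (Filter.eventually_le_atBot t)).exists
    rw [Real.norm_of_nonneg (hpos u h2 (hgap u h2)).le] at h1
    exact absurd (hmono h2 (Set.mem_Iic.2 le_rfl) h2) (not_le.2 h1)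

theorem exists_root_right {F : Set (ℝ × ℝ)} (hF : IsPartialIso F) {p q : Polynomial ℝ}
    (hd : SignMatch F p.derivative q.derivative)
    (hpq : ∀ z ∈ F, SignType.sign (p.eval z.1) = SignType.sign (q.eval z.2))
    {t s : ℝ} (hts : SamePos F t s) (ht' : 0 < p.derivative.eval t)
    (ht : p.eval t < 0) (hs : 0 ≤ q.eval s) : ∃ c, SamePos F c s ∧ p.eval c = 0 := by
  have hneg : ∀ {u v : ℝ}, SamePos F (-u) (-v) →
      SamePos ((fun z : ℝ × ℝ => (-z.1, -z.2)) ⁻¹' F) u v := by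
    intro u v h z hz
    have := h _ hz
    simp only [neg_lt_neg_iff] at this
    exact this.symm
  have hneg' : ∀ {u v : ℝ}, SamePos ((fun z : ℝ × ℝ => (-z.1, -z.2)) ⁻¹' F) u v →
      SamePos F (-u) (-v) := by
    intro u v h z hz
    have := h (-z.1, -z.2) (by simpa using hz)
    simp only [neg_lt, lt_neg] at this ⊢
    grind
  obtain ⟨c, hc, hc0⟩ := exists_root_left
    (F := (fun z : ℝ × ℝ => (-z.1, -z.2)) ⁻¹' F)
    (p := -(p.comp (-Polynomial.X))) (q := -(q.comp (-Polynomial.X))) (t := -t) (s := -s)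
    ⟨hF.1.preimage (fun a _ b _ h => by
      simp only [Prod.mk.injEq, neg_inj] at h
      exact Prod.ext h.1 h.2), fun z hz => hneg (hF.2 _ hz)⟩
    (fun u v huv => by
      simpa [Polynomial.derivative_comp] using hd _ _ (hneg' huv))
    (fun z hz => by simpa [Left.sign_neg] using hpq _ hz)
    (hneg (by simpa using hts)) (by simpa [Polynomial.derivative_comp] using ht')
    (by simpa using ht) (by simpa using hs)
  exact ⟨-c, by simpa using hneg' hc, by simpa using hc0⟩

theorem exists_root {F : Set (ℝ × ℝ)} (hF : IsPartialIso F) {p q : Polynomial ℝ}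
    (hd : SignMatch F p.derivative q.derivative)
    (hpq : ∀ z ∈ F, SignType.sign (p.eval z.1) = SignType.sign (q.eval z.2))
    {t s : ℝ} (hts : SamePos F t s) (ht' : p.derivative.eval t ≠ 0)
    (ht : p.eval t ≠ 0) (hne : SignType.sign (p.eval t) ≠ SignType.sign (q.eval s)) :
    ∃ c, SamePos F c s ∧ p.eval c = 0 := by
  have hdn : SignMatch F (-p).derivative (-q).derivative := by
    intro u v huv
    simpa [Left.sign_neg] using hd u v huv
  have hpqn : ∀ z ∈ F, SignType.sign ((-p).eval z.1) = SignType.sign ((-q).eval z.2) := by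
    intro z hz
    simpa [Left.sign_neg] using hpq z hz
  rcases lt_or_gt_of_ne ht with h | h
  · have hs : 0 ≤ q.eval s := by
      by_contra! h'
      exact hne (by rw [sign_neg h, sign_neg h'])
    rcases lt_or_gt_of_ne ht' with h' | h'
    · simpa using exists_root_left hF hdn hpqn hts (by simpa using h') (by simpa using h)
        (by simpa using hs)
    · exact exists_root_right hF hd hpq hts h' h hs
  · have hs : q.eval s ≤ 0 := by
      by_contra! h'
      exact hne (by rw [sign_pos h, sign_pos h'])
    rcases lt_or_gt_of_ne ht' with h' | h'
    · simpa using exists_root_right hF hdn hpqn hts (by simpa using h') (by simpa using h)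
        (by simpa using hs)
    · exact exists_root_left hF hd hpq hts h' h hs

/-- Adding the roots of `p` and `q` to a partial isomorphism that matches their derivatives. -/
theorem exists_extension {F : Set (ℝ × ℝ)} (hF : IsPartialIso F) {p q : Polynomial ℝ}
    (hd : SignMatch F p.derivative q.derivative)
    (hpq : ∀ z ∈ F, SignType.sign (p.eval z.1) = SignType.sign (q.eval z.2))
    (hp : p.derivative ≠ 0) (hq : q.derivative ≠ 0) :
    ∃ F', F ⊆ F' ∧ IsPartialIso F' ∧ SignMatch F' p q := by
  have rolle : ∀ {F : Set (ℝ × ℝ)} {p q : Polynomial ℝ}, IsPartialIso F →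
      SignMatch F p.derivative q.derivative → p.derivative ≠ 0 → ∀ {c c' d d' : ℝ},
      SamePos F c d → SamePos F c' d' → p.eval c = 0 → p.eval c' = 0 → c < c' → d < d' := by
    intro F p q hF hd hp c c' d d' h h' hc hc' hlt
    obtain ⟨u, hu, hu0⟩ := exists_hasDerivAt_eq_zero hlt p.continuous.continuousOn
      (hc.trans hc'.symm) (fun x _ => p.hasDerivAt x)
    obtain ⟨v, huv⟩ := hF.across u
    have hm := hd.mem_of_root hF hp huv hu0
    have h1 := h _ hm
    have h2 := h' _ hm
    have := hu.1
    have := hu.2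
    grind
  have opp : ∀ {F : Set (ℝ × ℝ)} {p q : Polynomial ℝ}, IsPartialIso F →
      SignMatch F p.derivative q.derivative →
      (∀ z ∈ F, SignType.sign (p.eval z.1) = SignType.sign (q.eval z.2)) →
      q.derivative ≠ 0 → ∀ {t s : ℝ},
      SamePos F t s → p.eval t = 0 → ∃ d, SamePos F t d ∧ q.eval d = 0 := by
    intro F p q hF hd hpq hq t s hts ht
    by_cases hs : q.eval s = 0
    · exact ⟨s, hts, hs⟩
    by_cases hs' : q.derivative.eval s = 0
    · have hm := hd.swap.mem_of_root hF.swap hq hts.swap hs'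
      have := hpq _ hm
      simp only [Prod.swap_prod_mk, ht, sign_zero] at this
      exact ⟨s, hts, sign_eq_zero_iff.1 this.symm⟩
    obtain ⟨d, h1, h2⟩ := exists_root hF.swap hd.swap (fun z hz => (hpq _ hz).symm) hts.swap hs' hs
      (by
        rw [ht, sign_zero]
        exact fun h => hs (sign_eq_zero_iff.1 h))
    exact ⟨d, h1.swap, h2⟩
  have hp0 : p ≠ 0 := by
    rintro rfl
    simp at hp
  have hq0 : q ≠ 0 := by
    rintro rfl
    simp at hq
  refine ⟨F ∪ {z | p.eval z.1 = 0 ∧ q.eval z.2 = 0 ∧ SamePos F z.1 z.2},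
    Set.subset_union_left, ⟨hF.1.union ?_, ?_⟩, ?_⟩
  · refine ((Polynomial.finite_setOfPred_isRoot hp0).prod (Polynomial.finite_setOfPred_isRoot hq0)).subset ?_
    rintro z ⟨h1, h2, -⟩
    exact ⟨h1, h2⟩
  · rintro z (hz | ⟨h1, h2, hz⟩) w (hw | ⟨k1, k2, hw⟩)
    · exact hF.2 z hz w hw
    · have := hw z hz
      exact ⟨this.2, this.1⟩
    · exact hz w hw
    · refine ⟨⟨fun h => rolle hF hd hp hw hz k1 h1 h, fun h => rolle hF.swap hd.swap hq hw.swap hz.swap k2 h2 h⟩,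
        ⟨fun h => rolle hF hd hp hz hw h1 k1 h, fun h => rolle hF.swap hd.swap hq hz.swap hw.swap h2 k2 h⟩⟩
  · intro t s hts'
    have hts : SamePos F t s := fun z hz => hts' z (Or.inl hz)
    by_cases ht : p.eval t = 0
    · obtain ⟨d, h1, h2⟩ := opp hF hd hpq hq hts ht
      have := hts' (t, d) (Or.inr ⟨ht, h2, h1⟩)
      have : d = s := by grind
      rw [ht, ← this, h2]
    by_cases hs : q.eval s = 0
    · obtain ⟨c, h1, h2⟩ := opp hF.swap hd.swap (fun z hz => (hpq _ hz).symm) hp hts.swap hs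
      have := hts' (c, s) (Or.inr ⟨h2, hs, h1.swap⟩)
      have : c = t := by grind
      rw [hs, ← this, h2]
    by_contra hne
    have ht' : p.derivative.eval t ≠ 0 := by
      intro h
      exact hne (hpq _ (hd.mem_of_root hF hp hts h))
    obtain ⟨c, hc, hc0⟩ := exists_root hF hd hpq hts ht' ht hne
    obtain ⟨d, hcd, hd0⟩ := opp hF hd hpq hq hc hc0
    have hcmp := hts' (c, d) (Or.inr ⟨hc0, hd0, hcd⟩)
    have htd : SamePos F t d := by
      intro z hz
      have := hts z hz
      have := hc z hz
      have := hcd z hz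
      grind
    have e1 := poly_sign_mvt p (u := c) (v := t) (ε := SignType.sign (q.derivative.eval s))
      (fun w hw => hd w s (hc.convex hts hw))
    have e2 := poly_sign_mvt q (u := d) (v := s) (ε := SignType.sign (p.derivative.eval t))
      (fun w hw => (hd t w (SamePos.convex htd.swap hts.swap hw).swap).symm)
    rw [hc0, sub_zero] at e1
    rw [hd0, sub_zero] at e2
    apply hne
    rw [e1, e2, hd t s hts]
    congr 1
    simp only at hcmp
    rcases lt_trichotomy c t with h | h | h
    · rw [sign_pos (sub_pos.2 h), sign_pos (sub_pos.2 (hcmp.1.1 h))]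
    · have : d = s := by grind
      simp [h, this]
    · rw [sign_neg (sub_neg.2 h), sign_neg (sub_neg.2 (hcmp.2.1 h))]

theorem exists_restriction {F : Set (ℝ × ℝ)} (hF : IsPartialIso F) {ι : Type*}
    (p q : ι → Polynomial ℝ) (h : ∀ i, SignMatch F (p i) (q i)) :
    ∃ F', F' ⊆ F ∧ IsPartialIso F' ∧ (∀ i, SignMatch F' (p i) (q i)) ∧
      ∀ z ∈ F', ∃ i, p i ≠ 0 ∧ (p i).eval z.1 = 0 := by
  refine ⟨{z ∈ F | ∃ i, p i ≠ 0 ∧ (p i).eval z.1 = 0}, Set.sep_subset _ _,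
    ⟨hF.1.subset (Set.sep_subset _ _), fun z hz w hw => hF.2 z hz.1 w hw.1⟩, ?_, fun z hz => hz.2⟩
  intro i t s hts
  obtain ⟨s', hs'⟩ := hF.across t
  rw [h i t s' hs']
  by_cases hq : q i = 0
  · simp [hq]
  by_contra hne
  have : ∃ w ∈ Set.uIcc s s', (q i).eval w = 0 := by
    apply intermediate_value_uIcc (q i).continuous.continuousOn
    rw [Set.mem_uIcc]
    by_contra! hc
    rcases lt_trichotomy ((q i).eval s) 0 with a | a | a <;>
    rcases lt_trichotomy ((q i).eval s') 0 with b | b | b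
    all_goals first
      | (exfalso
         simp [a, b] at hne
         done)
      | (exfalso
         grind)
  obtain ⟨w, hw, hw0⟩ := this
  obtain ⟨z, hz⟩ := hF.swap.across w
  have hm : (z, w) ∈ F := (h i).swap.mem_of_root hF.swap hq hz hw0
  have hp : p i ≠ 0 := by
    intro hp
    apply hq
    refine Polynomial.funext fun v => ?_
    obtain ⟨u, hu⟩ := hF.swap.across v
    have := h i u v hu.swap
    rw [hp, Polynomial.eval_zero, sign_zero] at this
    simpa using sign_eq_zero_iff.1 this.symm
  have hz0 : (p i).eval z = 0 := by
    have := h i z w hz.swap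
    rw [hw0, sign_zero] at this
    exact sign_eq_zero_iff.1 this
  have k1 := hts (z, w) ⟨hm, i, hp, hz0⟩
  have k2 := hs' (z, w) hm
  rw [Set.mem_uIcc] at hw
  have : s = s' := by grind
  exact hne (by rw [this])

theorem pseudo_div {A : Type*} [CommRing A] (g : Polynomial A) (k : ℕ) (hk : 0 < k)
    (hg : g.natDegree ≤ k) (p : Polynomial A) :
    ∃ (N : ℕ) (q r : Polynomial A),
      Polynomial.C (g.coeff k ^ N) * p = g * q + r ∧ r.natDegree < k := by
  induction hn : p.natDegree using Nat.strong_induction_on generalizing p with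
  | _ n ih =>
    by_cases hlt : n < k
    · exact ⟨0, 0, p, by simp, by omega⟩
    push Not at hlt
    obtain ⟨N, q, r, h1, h2⟩ := ih (m :=
        (Polynomial.C (g.coeff k) * p
          - Polynomial.C p.leadingCoeff * (Polynomial.X ^ (n - k) * g)).natDegree) (by
      suffices (Polynomial.C (g.coeff k) * p
          - Polynomial.C p.leadingCoeff * (Polynomial.X ^ (n - k) * g)).natDegree ≤ n - 1 by omega
      rw [Polynomial.natDegree_le_iff_coeff_eq_zero]
      intro i hi
      have hni : n ≤ i := by omega
      rw [Polynomial.coeff_sub, Polynomial.coeff_C_mul, Polynomial.coeff_C_mul,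
        Polynomial.coeff_X_pow_mul', if_pos (by omega)]
      rcases hni.eq_or_lt with rfl | h
      · rw [Nat.sub_sub_self hlt, ← hn, Polynomial.coeff_natDegree]
        ring
      · rw [Polynomial.coeff_eq_zero_of_natDegree_lt (p := p) (n := i) (by omega),
          Polynomial.coeff_eq_zero_of_natDegree_lt (p := g) (n := i - (n - k)) (by omega)]
        simp) _ rfl
    refine ⟨N + 1, q + Polynomial.C (g.coeff k ^ N * p.leadingCoeff) * Polynomial.X ^ (n - k), r,
      ?_, h2⟩
    rw [mul_sub, sub_eq_iff_eq_add] at h1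
    rw [pow_succ, Polynomial.C_mul, mul_assoc, h1, Polynomial.C_mul]
    ring


/-- Remainders of `p` modulo all truncations of `g`. -/
theorem exists_remainders {A : Type*} [CommRing A] (d : ℕ) (g p : Polynomial A) :
    ∃ R : ℕ → Polynomial A, (∀ k ≤ d + 1, (R k).natDegree ≤ d) ∧
      ∀ φ : A →+* ℝ, g.map φ ≠ 0 → ∀ z : ℝ, (g.map φ).eval z = 0 →
        SignType.sign ((p.map φ).eval z)
          = SignType.sign (((R (g.map φ).natDegree).map φ).eval z) := by
  have key : ∀ k : ℕ, ∃ r : Polynomial A, (k ≤ d + 1 → r.natDegree ≤ d) ∧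
      ∀ φ : A →+* ℝ, g.map φ ≠ 0 → (g.map φ).natDegree = k → ∀ z : ℝ, (g.map φ).eval z = 0 →
        SignType.sign ((p.map φ).eval z) = SignType.sign ((r.map φ).eval z) := by
    intro k
    rcases Nat.eq_zero_or_pos k with rfl | hk
    · refine ⟨0, by simp, fun φ h0 hdeg z hz => ?_⟩
      rw [Polynomial.eq_C_of_natDegree_eq_zero hdeg, Polynomial.eval_C] at hz
      rw [Polynomial.eq_C_of_natDegree_eq_zero hdeg, hz] at h0
      simp at h0
    · set g' : Polynomial A := ∑ i ∈ Finset.range (k + 1), Polynomial.monomial i (g.coeff i) with hg'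
      have hco : ∀ i, g'.coeff i = if i ≤ k then g.coeff i else 0 := by
        intro i
        simp [hg', Polynomial.finsetSum_coeff, Polynomial.coeff_monomial]
      have hdeg' : g'.natDegree ≤ k := by
        rw [Polynomial.natDegree_le_iff_coeff_eq_zero]
        intro i hi
        rw [hco, if_neg (by omega)]
      obtain ⟨N, q, r, h1, h2⟩ := pseudo_div g' k hk hdeg' p
      refine ⟨Polynomial.C (g.coeff k ^ N) * r,
        fun hkd => (Polynomial.natDegree_C_mul_le _ _).trans (by omega), fun φ h0 hdeg z hz => ?_⟩
      have hgg : g'.map φ = g.map φ := by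
        ext i
        rw [Polynomial.coeff_map, Polynomial.coeff_map, hco]
        split_ifs with h
        · rfl
        · rw [map_zero, ← Polynomial.coeff_map, Polynomial.coeff_eq_zero_of_natDegree_lt (by omega)]
      have hlc : φ (g.coeff k) ≠ 0 := by
        rw [← Polynomial.coeff_map, ← hdeg, Polynomial.coeff_natDegree]
        exact Polynomial.leadingCoeff_ne_zero.2 h0
      have e := congrArg (fun f => (f.map φ).eval z) h1
      simp only [Polynomial.map_mul, Polynomial.map_add, Polynomial.map_C, Polynomial.eval_mul,
        Polynomial.eval_add, Polynomial.eval_C, hgg, hz, zero_mul, zero_add, hco, le_refl,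
        if_true] at e
      rw [Polynomial.map_mul, Polynomial.map_C, Polynomial.eval_mul, Polynomial.eval_C, ← e,
        ← mul_assoc, sign_mul, sign_pos (a := φ (g.coeff k ^ N) * φ (g.coeff k ^ N)), one_mul]
      rw [map_pow]
      exact mul_self_pos.2 (pow_ne_zero N hlc)
  choose R h1 h2 using key
  exact ⟨R, h1, fun φ h0 z hz => h2 _ φ h0 rfl z hz⟩

/-- A finite set of functions of the parameter whose signs determine, up to a partial isomorphism,
the sign behaviour on the line of all polynomials in `P`. -/
def SignsDetermined {X A : Type*} [CommRing A] (ev : X → A →+* ℝ) (P : Set (Polynomial A)) : Prop :=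
  ∃ C : Set A, C.Finite ∧ ∀ x y,
    (∀ c ∈ C, SignType.sign (ev x c) = SignType.sign (ev y c)) →
      ∃ F, IsPartialIso F ∧ ∀ p ∈ P, SignMatch F (p.map (ev x)) (p.map (ev y))

theorem signsDetermined_step {X A : Type*} [CommRing A] (ev : X → A →+* ℝ) (d : ℕ)
    (P : Set (Polynomial A)) (hP : P.Finite) (hPd : ∀ g ∈ P, g.natDegree ≤ d + 1)
    (p : Polynomial A) (hp : p.natDegree ≤ d + 1) :
    ∃ R : Set (Polynomial A), R.Finite ∧ (∀ r ∈ R, r.natDegree ≤ d) ∧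
      (SignsDetermined ev (P ∪ R) → SignsDetermined ev (insert p P)) := by
  have hp' : p.derivative.natDegree ≤ d :=
    (Polynomial.natDegree_derivative_le p).trans (by omega)
  choose R hR1 hR2 using fun g => exists_remainders d g p
  set G : Set (Polynomial A) := insert p.derivative P with hG
  have hGfin : G.Finite := hP.insert _
  have hGd : ∀ g ∈ G, g.natDegree ≤ d + 1 := by
    rintro g (rfl | hg)
    · omega
    · exact hPd g hg
  refine ⟨insert p.derivative (⋃ g ∈ G, R g '' Set.Iic (d + 1)),
    (hGfin.biUnion fun g _ => (Set.finite_Iic _).image _).insert _, ?_, ?_⟩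
  · rintro r (rfl | hr)
    · exact hp'
    · simp only [Set.mem_iUnion] at hr
      obtain ⟨g, -, k, hk, rfl⟩ := hr
      exact hR1 g k hk
  rintro ⟨C, hC, h⟩
  refine ⟨insert (p.coeff 0) (C ∪ ⋃ g ∈ G, g.coeff '' Set.Iic (d + 1)),
    (hC.union (hGfin.biUnion fun g _ => (Set.finite_Iic _).image _)).insert _, ?_⟩
  intro x y hxy
  have hp0 := hxy _ (Or.inl rfl)
  have hcoef : ∀ g ∈ G, ∀ i, (g.map (ev x)).coeff i = 0 ↔ (g.map (ev y)).coeff i = 0 := by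
    intro g hg i
    by_cases hi : i ≤ d + 1
    · have := hxy (g.coeff i) (Or.inr (Or.inr (Set.mem_biUnion hg ⟨i, hi, rfl⟩)))
      rw [Polynomial.coeff_map, Polynomial.coeff_map, ← sign_eq_zero_iff, this, sign_eq_zero_iff]
    · have : g.coeff i = 0 :=
        Polynomial.coeff_eq_zero_of_natDegree_lt ((hGd g hg).trans_lt (by omega))
      simp [Polynomial.coeff_map, this]
  have hzero : ∀ g ∈ G, (g.map (ev x) = 0 ↔ g.map (ev y) = 0) := by
    intro g hg
    simp only [Polynomial.ext_iff, Polynomial.coeff_zero, hcoef g hg]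
  have hnat : ∀ g ∈ G, (g.map (ev x)).natDegree = (g.map (ev y)).natDegree := by
    intro g hg
    apply le_antisymm <;> rw [Polynomial.natDegree_le_iff_coeff_eq_zero] <;> intro i hi
    · rw [hcoef g hg]
      exact Polynomial.coeff_eq_zero_of_natDegree_lt hi
    · rw [← hcoef g hg]
      exact Polynomial.coeff_eq_zero_of_natDegree_lt hi
  obtain ⟨F, hF, hFm⟩ := h x y (fun c hc => hxy c (Or.inr (Or.inl hc)))
  have hFG : ∀ g ∈ G, SignMatch F (g.map (ev x)) (g.map (ev y)) := by
    rintro g (rfl | hg)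
    · exact hFm _ (Or.inr (Or.inl rfl))
    · exact hFm _ (Or.inl hg)
  obtain ⟨F₁, hsub, hF₁, hm₁, hroot⟩ := exists_restriction hF
    (fun g : G => (g : Polynomial A).map (ev x)) (fun g : G => (g : Polynomial A).map (ev y))
    (fun g => hFG g g.2)
  have hsign : ∀ z ∈ F₁, SignType.sign ((p.map (ev x)).eval z.1)
      = SignType.sign ((p.map (ev y)).eval z.2) := by
    intro z hz
    obtain ⟨⟨g, hg⟩, hg0, hgz⟩ := hroot z hz
    simp only at hg0 hgz
    have hzF := hF.2 z (hsub hz)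
    have hgw : (g.map (ev y)).eval z.2 = 0 := by
      have := hFG g hg _ _ hzF
      rw [hgz, sign_zero] at this
      exact sign_eq_zero_iff.1 this.symm
    rw [hR2 g (ev x) hg0 _ hgz, hR2 g (ev y) (fun h0 => hg0 ((hzero g hg).2 h0)) _ hgw, ← hnat g hg]
    refine hFm _ (Or.inr (Or.inr (Set.mem_biUnion hg ⟨_, ?_, rfl⟩))) _ _ hzF
    exact Polynomial.natDegree_map_le.trans (hGd g hg)
  have hdG : p.derivative ∈ G := Or.inl rfl
  by_cases hd0 : p.derivative.map (ev x) = 0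
  · refine ⟨F₁, hF₁, ?_⟩
    rintro g (rfl | hg)
    · have hd1 := (hzero _ hdG).1 hd0
      rw [← Polynomial.derivative_map] at hd0 hd1
      intro t s _
      rw [Polynomial.eq_C_of_natDegree_eq_zero (Polynomial.derivative_eq_zero.1 hd0),
        Polynomial.eq_C_of_natDegree_eq_zero (Polynomial.derivative_eq_zero.1 hd1)]
      simpa using hp0
    · exact hm₁ ⟨g, Or.inr hg⟩
  · have hd1 := fun h0 => hd0 ((hzero _ hdG).2 h0)
    have hdm := hm₁ ⟨_, hdG⟩
    simp only at hdm
    rw [← Polynomial.derivative_map] at hd0 hd1 hdm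
    rw [← Polynomial.derivative_map] at hdm
    obtain ⟨F₂, h12, hF₂, hm₂⟩ := exists_extension hF₁ hdm hsign hd0 hd1
    refine ⟨F₂, hF₂, ?_⟩
    rintro g (rfl | hg)
    · exact hm₂
    · exact fun t s hts => hm₁ ⟨g, Or.inr hg⟩ t s (fun z hz => hts z (h12 hz))

theorem signsDetermined_of_finite {X A : Type*} [CommRing A] (ev : X → A →+* ℝ) (d : ℕ) :
    ∀ P : Set (Polynomial A), P.Finite → (∀ g ∈ P, g.natDegree ≤ d) → SignsDetermined ev P := by
  induction d with
  | zero =>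
    intro P hP hd
    refine ⟨(fun g => g.coeff 0) '' P, hP.image _, fun x y hxy =>
      ⟨∅, ⟨Set.finite_empty, by simp⟩, fun p hp t s _ => ?_⟩⟩
    rw [Polynomial.eq_C_of_natDegree_eq_zero (Nat.le_zero.1 (hd p hp))]
    simpa using hxy _ ⟨p, hp, rfl⟩
  | succ d ih =>
    have key : ∀ H : Set (Polynomial A), H.Finite → (∀ g ∈ H, g.natDegree ≤ d + 1) →
        ∀ L : Set (Polynomial A), L.Finite → (∀ g ∈ L, g.natDegree ≤ d) →
          SignsDetermined ev (H ∪ L) := by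
      intro H hH
      induction H, hH using Set.Finite.induction_on with
      | empty =>
        intro _ L hL hLd
        rw [Set.empty_union]
        exact ih L hL hLd
      | @insert p H _ hH ihH =>
        intro hHd L hL hLd
        obtain ⟨R, hR, hRd, hstep⟩ := signsDetermined_step ev d (H ∪ L) (hH.union hL)
          (by
            rintro g (hg | hg)
            · exact hHd g (Or.inr hg)
            · exact (hLd g hg).trans (by omega))
          p (hHd p (Or.inl rfl))
        rw [Set.insert_union]
        apply hstep
        rw [Set.union_assoc]
        refine ihH (fun g hg => hHd g (Or.inr hg)) _ (hL.union hR) ?_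
        rintro g (hg | hg)
        · exact hLd g hg
        · exact hRd g hg
    intro P hP hd
    have := key P hP hd ∅ Set.finite_empty (by simp)
    rwa [Set.union_empty] at this

open MvPolynomial in
theorem isSemialgebraic_iff {σ : Type*} {S : Set (σ → ℝ)} :
    IsSemialgebraic S ↔ ∃ C : Set (MvPolynomial σ ℝ), C.Finite ∧ ∀ x y,
      (∀ c ∈ C, SignType.sign (eval x c) = SignType.sign (eval y c)) → x ∈ S → y ∈ S := by
  classical
  constructor
  · rintro ⟨𝓑, hfin, hB, rfl⟩
    choose! f G hfG using hB
    refine ⟨⋃ B ∈ 𝓑, insert (f B) (G B : Set (MvPolynomial σ ℝ)),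
      hfin.biUnion fun B _ => (G B).finite_toSet.insert _, ?_⟩
    rintro x y hxy ⟨B, hB, hx⟩
    refine ⟨B, hB, ?_⟩
    rw [hfG B hB] at hx ⊢
    refine ⟨?_, fun g hg => ?_⟩
    · rw [← sign_eq_zero_iff, ← hxy _ (Set.mem_biUnion hB (Or.inl rfl)), sign_eq_zero_iff]
      exact hx.1
    · rw [← sign_eq_one_iff, ← hxy _ (Set.mem_biUnion hB (Or.inr hg)), sign_eq_one_iff]
      exact hx.2 g hg
  · rintro ⟨C, hC, h⟩
    have := hC.fintype
    let cell : (C → SignType) → Set (σ → ℝ) := fun ε =>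
      {x | ∀ c : C, SignType.sign (eval x (c : MvPolynomial σ ℝ)) = ε c}
    refine ⟨cell '' {ε | ∃ x ∈ S, x ∈ cell ε}, (Set.toFinite _).image _, ?_, ?_⟩
    · rintro _ ⟨ε, -, rfl⟩
      refine ⟨∑ c : C, (if ε c = 0 then (c : MvPolynomial σ ℝ) ^ 2 else 0),
        Finset.univ.image (fun c : C => if ε c = 0 then 1 else
          if ε c = 1 then (c : MvPolynomial σ ℝ) else -(c : MvPolynomial σ ℝ)), ?_⟩
      ext x
      have h0 : eval x (∑ c : C, (if ε c = 0 then (c : MvPolynomial σ ℝ) ^ 2 else 0)) = 0 ↔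
          ∀ c : C, ε c = 0 → eval x (c : MvPolynomial σ ℝ) = 0 := by
        rw [map_sum, Finset.sum_eq_zero_iff_of_nonneg
          (fun c _ => by split_ifs <;> simp [sq_nonneg])]
        refine forall_congr' fun c => ?_
        by_cases hc : ε c = 0 <;> simp [hc]
      simp only [cell, Set.mem_ofPred_eq, h0, Finset.mem_image, Finset.mem_univ, true_and,
        forall_exists_index, forall_apply_eq_imp_iff]
      rw [← forall_and]
      refine forall_congr' fun c => ?_
      rcases hε : ε c with _ | _ | _
      · simp [SignType.zero_eq_zero, sign_eq_zero_iff]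
      · simp [SignType.neg_eq_neg_one, sign_eq_neg_one_iff]
      · simp [SignType.pos_eq_one, sign_eq_one_iff]
    · ext x
      constructor
      · intro hx
        exact ⟨_, ⟨fun c => SignType.sign (eval x (c : MvPolynomial σ ℝ)), ⟨x, hx, fun _ => rfl⟩, rfl⟩,
          fun _ => rfl⟩
      · rintro ⟨_, ⟨ε, ⟨y, hy, hyε⟩, rfl⟩, hx⟩
        exact h y x (fun c hc => (hyε ⟨c, hc⟩).trans (hx ⟨c, hc⟩).symm) hy

theorem IsSemialgebraic.inter {σ : Type*} {S T : Set (σ → ℝ)} (hS : IsSemialgebraic S)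
    (hT : IsSemialgebraic T) : IsSemialgebraic (S ∩ T) := by
  rw [isSemialgebraic_iff] at hS hT ⊢
  obtain ⟨C, hC, h⟩ := hS
  obtain ⟨D, hD, k⟩ := hT
  exact ⟨C ∪ D, hC.union hD, fun x y hxy hx => ⟨h x y (fun c hc => hxy c (Or.inl hc)) hx.1,
    k x y (fun c hc => hxy c (Or.inr hc)) hx.2⟩⟩

open MvPolynomial in
/-- The zero set of a polynomial is semialgebraic. -/
theorem isSemialgebraic_zeros {σ : Type*} (p : MvPolynomial σ ℝ) :
    IsSemialgebraic {x | eval x p = 0} :=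
  ⟨{_}, Set.finite_singleton _, fun _ hB => ⟨p, ∅, by simpa using hB⟩, by simp⟩

open MvPolynomial in
/-- The preimage of a semialgebraic set under a polynomial map is semialgebraic. -/
theorem IsSemialgebraic.preimage {σ τ : Type*} {S : Set (τ → ℝ)} (hS : IsSemialgebraic S)
    (P : τ → MvPolynomial σ ℝ) : IsSemialgebraic {x : σ → ℝ | (fun i => eval x (P i)) ∈ S} := by
  rw [isSemialgebraic_iff] at hS ⊢
  obtain ⟨C, hC, h⟩ := hS
  have key : ∀ (x : σ → ℝ) (c : MvPolynomial τ ℝ),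
      eval x (aeval P c) = eval (fun i => eval x (P i)) c := by
    intro x c
    induction c using MvPolynomial.induction_on with
    | C a => simp
    | add p q hp hq => rw [map_add, map_add, map_add, hp, hq]
    | mul_X p i hp => rw [map_mul, map_mul, map_mul, hp, aeval_X, eval_X]
  refine ⟨(fun c => aeval P c) '' C, hC.image _, fun x y hxy hx => h _ _ (fun c hc => ?_) hx⟩
  rw [← key, ← key]
  exact hxy _ ⟨c, hc, rfl⟩

/-- The preimage of a semialgebraic set under a map that permutes, repeats or omits coordinates. -/
theorem IsSemialgebraic.reindex {σ τ : Type*} {S : Set (τ → ℝ)} (hS : IsSemialgebraic S)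
    (e : τ → σ) : IsSemialgebraic {x : σ → ℝ | (fun i => x (e i)) ∈ S} := by
  simpa using hS.preimage (fun i => MvPolynomial.X (e i))

open MvPolynomial in
theorem IsSemialgebraic.exists_option {σ : Type*} {S : Set (Option σ → ℝ)}
    (hS : IsSemialgebraic S) :
    IsSemialgebraic {x : σ → ℝ | ∃ t : ℝ, (fun o : Option σ => o.elim t x) ∈ S} := by
  rw [isSemialgebraic_iff] at hS ⊢
  obtain ⟨C, hC, h⟩ := hS
  have key : ∀ (x : σ → ℝ) (t : ℝ) (c : MvPolynomial (Option σ) ℝ),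
      ((optionEquivLeft ℝ σ c).map (eval x)).eval t = eval (fun o : Option σ => o.elim t x) c := by
    intro x t c
    induction c using MvPolynomial.induction_on with
    | C a => simp
    | add p q hp hq => simp [hp, hq]
    | mul_X p i hp => cases i <;> simp [hp]
  have hfin := hC.image (fun c => optionEquivLeft ℝ σ c)
  obtain ⟨d, hd⟩ := (hfin.image Polynomial.natDegree).bddAbove
  obtain ⟨D, hD, k⟩ := signsDetermined_of_finite (fun x : σ → ℝ => (eval x : _ →+* ℝ)) d _ hfin
    (fun g hg => hd ⟨g, hg, rfl⟩)
  refine ⟨D, hD, ?_⟩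
  rintro x y hxy ⟨t, ht⟩
  obtain ⟨F, hF, hm⟩ := k x y hxy
  obtain ⟨s, hs⟩ := hF.across t
  refine ⟨s, h _ _ (fun c hc => ?_) ht⟩
  rw [← key, ← key]
  exact hm _ ⟨c, hc, rfl⟩ t s hs


/-- The projection of a semialgebraic set is semialgebraic (Tarski and Seidenberg). -/
theorem IsSemialgebraic.exists_sum {σ τ : Type*} [Finite τ] {S : Set (σ ⊕ τ → ℝ)}
    (hS : IsSemialgebraic S) : IsSemialgebraic {x : σ → ℝ | ∃ y : τ → ℝ, Sum.elim x y ∈ S} := by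
  refine Finite.induction_empty_option (P := fun τ => ∀ S : Set (σ ⊕ τ → ℝ), IsSemialgebraic S →
    IsSemialgebraic {x : σ → ℝ | ∃ y : τ → ℝ, Sum.elim x y ∈ S}) ?_ ?_ ?_ τ S hS
  · intro α β e ih S hS
    convert ih _ (hS.reindex (Sum.map id e.symm)) using 1
    have key : ∀ (x : σ → ℝ) (y : α → ℝ), (fun i => Sum.elim x y (Sum.map id e.symm i))
        = Sum.elim x (y ∘ e.symm) := by
      intro x y
      funext i
      cases i <;> rfl
    ext x
    simp only [Set.mem_ofPred_eq, key]
    constructor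
    · rintro ⟨y, hy⟩
      exact ⟨y ∘ e, by simpa [Function.comp_assoc] using hy⟩
    · rintro ⟨y, hy⟩
      exact ⟨_, hy⟩
  · intro S hS
    convert hS.reindex (Sum.elim id PEmpty.elim) using 1
    have key : ∀ (x : σ → ℝ) (y : PEmpty → ℝ),
        Sum.elim x y = fun i => x (Sum.elim id PEmpty.elim i) := by
      intro x y
      funext i
      rcases i with i | ⟨⟨⟩⟩
      rfl
    ext x
    constructor
    · rintro ⟨y, h⟩
      rwa [key] at h
    · intro h
      refine ⟨PEmpty.elim, ?_⟩
      rwa [key]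
  · intro α _ ih S hS
    let e : σ ⊕ Option α → Option (σ ⊕ α) :=
      Sum.elim (fun i => some (Sum.inl i)) (fun o => o.elim none (fun a => some (Sum.inr a)))
    convert ih _ (hS.reindex e).exists_option using 1
    have key : ∀ (x : σ → ℝ) (y : α → ℝ) (t : ℝ),
        (fun i => (e i).elim t (Sum.elim x y)) = Sum.elim x (fun o : Option α => o.elim t y) := by
      intro x y t
      funext i
      rcases i with i | _ | i <;> rfl
    ext x
    simp only [Set.mem_ofPred_eq, key]
    constructor
    · rintro ⟨y, hy⟩
      refine ⟨fun a => y (some a), y none, ?_⟩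
      convert hy using 2
      funext o
      cases o <;> rfl
    · rintro ⟨y, t, hy⟩
      exact ⟨_, hy⟩

/-! ## Semialgebraic maps, rings of semialgebraic functions, induced homomorphisms -/

/-- The graph of `f : M → ℝ^τ`, as a subset of `ℝ^(σ ⊕ τ) = ℝ^σ × ℝ^τ`. -/
def graph {σ τ : Type*} {M : Set (σ → ℝ)} (f : M → τ → ℝ) : Set (σ ⊕ τ → ℝ) :=
  Set.range fun x : M => Sum.elim (x : σ → ℝ) (f x)

/-- A semialgebraic map between subsets of `ℝ^σ` and `ℝ^τ`: a continuous map with semialgebraic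
graph. The sets carry the subspace topology of the product topology, i.e. the Euclidean one. -/
def IsSemialgebraicMap {σ τ : Type*} {M : Set (σ → ℝ)} {N : Set (τ → ℝ)} (π : M → N) : Prop :=
  Continuous π ∧ IsSemialgebraic (graph fun x : M => (π x : τ → ℝ))

/-- A continuous real-valued function on `M ⊆ ℝ^σ` is semialgebraic if its graph is. -/
def IsSemialgebraicFun {σ : Type*} {M : Set (σ → ℝ)} (f : C(M, ℝ)) : Prop :=
  IsSemialgebraic (graph fun (x : M) (_ : Unit) => f x)

theorem mem_graph {σ τ : Type*} {M : Set (σ → ℝ)} {f : M → τ → ℝ} {v : σ ⊕ τ → ℝ} :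
    v ∈ graph f ↔ ∃ h : (fun i => v (Sum.inl i)) ∈ M, ∀ j, v (Sum.inr j) = f ⟨_, h⟩ j := by
  constructor
  · rintro ⟨x, rfl⟩
    exact ⟨x.2, fun j => rfl⟩
  · rintro ⟨h, hv⟩
    refine ⟨⟨_, h⟩, ?_⟩
    funext i
    rcases i with i | j
    · rfl
    · exact (hv j).symm

theorem IsSemialgebraicFun.binop {σ : Type*} {M : Set (σ → ℝ)} {f g h : C(M, ℝ)}
    (hf : IsSemialgebraicFun f) (hg : IsSemialgebraicFun g) (op : ℝ → ℝ → ℝ)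
    (hop : ∀ x, h x = op (f x) (g x)) (P : MvPolynomial Bool ℝ)
    (hP : ∀ w : Bool → ℝ, MvPolynomial.eval w P = op (w false) (w true)) :
    IsSemialgebraicFun h := by
  have h1 := hf.reindex (Sum.elim (fun i => Sum.inl (Sum.inl i)) (fun _ => Sum.inr false) :
    σ ⊕ Unit → (σ ⊕ Unit) ⊕ Bool)
  have h2 := hg.reindex (Sum.elim (fun i => Sum.inl (Sum.inl i)) (fun _ => Sum.inr true) :
    σ ⊕ Unit → (σ ⊕ Unit) ⊕ Bool)
  have h3 := isSemialgebraic_zeros (MvPolynomial.X (Sum.inl (Sum.inr ()))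
    - MvPolynomial.rename Sum.inr P : MvPolynomial ((σ ⊕ Unit) ⊕ Bool) ℝ)
  unfold IsSemialgebraicFun
  convert ((h1.inter h2).inter h3).exists_sum using 1
  ext v
  simp only [mem_graph, Set.mem_inter_iff, Set.mem_ofPred_eq, Sum.elim_inl, Sum.elim_inr, map_sub,
    MvPolynomial.eval_X, MvPolynomial.eval_rename, hP, Function.comp_apply, sub_eq_zero, hop,
    forall_const]
  constructor
  · rintro ⟨hM, hv⟩
    exact ⟨fun b => if b then g ⟨_, hM⟩ else f ⟨_, hM⟩, ⟨⟨hM, by simp⟩, ⟨hM, by simp⟩⟩,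
      by simpa using hv ()⟩
  · rintro ⟨y, ⟨⟨hM, h1⟩, ⟨_, h2⟩⟩, h3⟩
    exact ⟨hM, fun _ => by rw [h3, h1, h2]⟩

theorem isSemialgebraicFun_const {σ : Type*} {M : Set (σ → ℝ)} (hM : IsSemialgebraic M) (r : ℝ) :
    IsSemialgebraicFun (ContinuousMap.const M r) := by
  have h1 := hM.reindex (Sum.inl : σ → σ ⊕ Unit)
  have h2 := isSemialgebraic_zeros (MvPolynomial.X (Sum.inr ()) - MvPolynomial.C r :
    MvPolynomial (σ ⊕ Unit) ℝ)
  unfold IsSemialgebraicFun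
  convert h1.inter h2 using 1
  ext v
  simp only [mem_graph, Set.mem_inter_iff, Set.mem_ofPred_eq, map_sub, MvPolynomial.eval_X,
    MvPolynomial.eval_C, sub_eq_zero, ContinuousMap.const_apply, exists_prop]
  exact and_congr_right fun _ => ⟨fun h => h (), fun h _ => h⟩

theorem IsSemialgebraicFun.comp {σ τ : Type*} [Finite τ] {M : Set (σ → ℝ)} {N : Set (τ → ℝ)}
    {g : C(N, ℝ)} (hg : IsSemialgebraicFun g) {π : M → N} (hπ : IsSemialgebraicMap π) :
    IsSemialgebraicFun (g.comp ⟨π, hπ.1⟩) := by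
  have h1 := hπ.2.reindex (Sum.elim (fun i => Sum.inl (Sum.inl i)) (fun j => Sum.inr j) :
    σ ⊕ τ → (σ ⊕ Unit) ⊕ τ)
  have h2 := hg.reindex (Sum.elim (fun j => Sum.inr j) (fun _ => Sum.inl (Sum.inr ())) :
    τ ⊕ Unit → (σ ⊕ Unit) ⊕ τ)
  unfold IsSemialgebraicFun
  convert (h1.inter h2).exists_sum using 1
  ext v
  simp only [mem_graph, Set.mem_inter_iff, Set.mem_ofPred_eq, Sum.elim_inl, Sum.elim_inr,
    forall_const, ContinuousMap.comp_apply, ContinuousMap.coe_mk]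
  constructor
  · rintro ⟨hM, hv⟩
    exact ⟨π ⟨_, hM⟩, ⟨hM, fun _ => rfl⟩, ⟨(π ⟨_, hM⟩).2, hv ()⟩⟩
  · rintro ⟨y, ⟨hM, h1⟩, ⟨hN, h2⟩⟩
    refine ⟨hM, fun _ => h2.trans ?_⟩
    congr 1
    exact Subtype.ext (funext h1)

/-- The `ℝ`-algebra `𝒮(M)` of continuous semialgebraic functions on a semialgebraic set `M`, with
pointwise operations. -/
def semialgebraicFunctions {σ : Type*} {M : Set (σ → ℝ)} (hM : IsSemialgebraic M) :
    Subalgebra ℝ C(M, ℝ) where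
  carrier := {f | IsSemialgebraicFun f}
  add_mem' hf hg := hf.binop hg (· + ·) (fun _ => rfl)
    (MvPolynomial.X false + MvPolynomial.X true) (by simp)
  mul_mem' hf hg := hf.binop hg (· * ·) (fun _ => rfl)
    (MvPolynomial.X false * MvPolynomial.X true) (by simp)
  algebraMap_mem' r := isSemialgebraicFun_const hM r

/-- The homomorphism `φ_π : 𝒮(N) → 𝒮(M)`, `g ↦ g ∘ π`, induced by a semialgebraic map
`π : M → N`. -/
def inducedHom {σ τ : Type*} [Finite τ] {M : Set (σ → ℝ)} {N : Set (τ → ℝ)}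
    (hM : IsSemialgebraic M) (hN : IsSemialgebraic N) (π : M → N) (hπ : IsSemialgebraicMap π) :
    semialgebraicFunctions hN →ₐ[ℝ] semialgebraicFunctions hM where
  toFun g := ⟨(g : C(N, ℝ)).comp ⟨π, hπ.1⟩, IsSemialgebraicFun.comp g.2 hπ⟩
  map_one' := rfl
  map_mul' _ _ := rfl
  map_zero' := rfl
  map_add' _ _ := rfl
  commutes' _ := rfl

/-- `π` is locally injective: `M` is covered by open semialgebraic subsets on each of which `π` is
injective. -/
def LocallyInjective {σ τ : Type*} {M : Set (σ → ℝ)} {N : Set (τ → ℝ)} (π : M → N) : Prop :=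
  ∃ 𝓤 : Set (Set M), (∀ U ∈ 𝓤, IsOpen U ∧ IsSemialgebraic ((↑) '' U : Set (σ → ℝ)) ∧
    Set.InjOn π U) ∧ ⋃₀ 𝓤 = Set.univ

end Semialg

namespace Semialg

/-! ## Semialgebraic conditions -/

/-! Local injectivity gives finiteness by a partition of unity. By compactness of `M`, finitely many
balls with centres `x` and closed balls on which `π` is injective cover `M`. The functions `θ x`,
positive inside the ball at `x` and zero outside it, have a positive sum `Θ`. On each closed ball `f
/ Θ` factors through `π`, and the factor extends to a semialgebraic function `g x` on `N`. Hence `f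
= ∑ (g x ∘ π) * θ x`, so the `θ x` generate.

The extension step (`exists_semialgebraic_extension`, applied in `exists_factorization`) rests on
Hausdorff's formula `min (h c * d(z, c)) / min d(z, c)`, for positive `h` whose values differ by a
factor of at most 2. With `d` the squared distance, a polynomial, this formula is first-order over
the graph of `h`, so by Tarski-Seidenberg the extension is semialgebraic.

Finiteness gives local injectivity by a cube root trick (`eventually_injective_of_generators`). Let
`b i` be generators, fix `x₀`, and let `f i` be the cube root of `b i - b i x₀`. Expand the `f i` in
the generators, with coefficients bounded since `N` is compact. On pairs in one fibre of `π`, the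
differences of the `f i` are then bounded by a constant times the differences of the `b j`. But the
difference of `b i = f i ^ 3 + const` is that of `f i` times a factor that tends to zero at `x₀`.
Near `x₀` the differences of the `b j` therefore vanish, and so do those of the coordinates, which
the `b j` generate as well. -/

theorem IsSemialgebraic.compl {σ : Type*} {S : Set (σ → ℝ)} (hS : IsSemialgebraic S) :
    IsSemialgebraic Sᶜ := by
  rw [isSemialgebraic_iff] at hS ⊢
  obtain ⟨C, hC, h⟩ := hS
  -- Agreement of signs is symmetric, so the same polynomials that decide membership in `S` decide
  -- membership in its complement.
  exact ⟨C, hC, fun x y hxy hx hy => hx (h y x (fun c hc => (hxy c hc).symm) hy)⟩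

theorem IsSemialgebraic.union {σ : Type*} {S T : Set (σ → ℝ)} (hS : IsSemialgebraic S)
    (hT : IsSemialgebraic T) : IsSemialgebraic (S ∪ T) := by
  rw [← compl_compl (S ∪ T), Set.compl_union]
  exact (hS.compl.inter hT.compl).compl

/-- Tarski-Seidenberg as a rule for quantifiers: with `forall`, `imp`, `inter` and `union` it lets a
set defined by a first-order formula be treated one connective at a time. -/
theorem IsSemialgebraic.exists {σ τ : Type*} [Finite τ] {P : (σ → ℝ) → (τ → ℝ) → Prop}
    (h : IsSemialgebraic {v : σ ⊕ τ → ℝ | P (fun i => v (Sum.inl i)) (fun j => v (Sum.inr j))}) :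
    IsSemialgebraic {x | ∃ y, P x y} :=
  h.exists_sum

theorem IsSemialgebraic.forall {σ τ : Type*} [Finite τ] {P : (σ → ℝ) → (τ → ℝ) → Prop}
    (h : IsSemialgebraic {v : σ ⊕ τ → ℝ | P (fun i => v (Sum.inl i)) (fun j => v (Sum.inr j))}) :
    IsSemialgebraic {x | ∀ y, P x y} := by
  convert (IsSemialgebraic.exists (P := fun x y => ¬ P x y) h.compl).compl using 1
  ext x
  simp

theorem IsSemialgebraic.imp {σ : Type*} {P Q : (σ → ℝ) → Prop}
    (hP : IsSemialgebraic {x | P x}) (hQ : IsSemialgebraic {x | Q x}) :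
    IsSemialgebraic {x | P x → Q x} := by
  convert hP.compl.union hQ using 1
  ext x
  simp [imp_iff_not_or]

/-- `p` is given by a polynomial. -/
def IsPolynomialFun {σ : Type*} (p : (σ → ℝ) → ℝ) : Prop :=
  ∃ P : MvPolynomial σ ℝ, ∀ x, MvPolynomial.eval x P = p x

namespace IsPolynomialFun

variable {σ ι : Type*} {p q : (σ → ℝ) → ℝ}

theorem coord (i : σ) : IsPolynomialFun fun x : σ → ℝ => x i :=
  ⟨MvPolynomial.X i, by simp⟩

theorem const (r : ℝ) : IsPolynomialFun fun _ : σ → ℝ => r :=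
  ⟨MvPolynomial.C r, by simp⟩

theorem sub (hp : IsPolynomialFun p) (hq : IsPolynomialFun q) :
    IsPolynomialFun fun x => p x - q x := by
  obtain ⟨P, hP⟩ := hp
  obtain ⟨Q, hQ⟩ := hq
  exact ⟨P - Q, by simp [hP, hQ]⟩

theorem mul (hp : IsPolynomialFun p) (hq : IsPolynomialFun q) :
    IsPolynomialFun fun x => p x * q x := by
  obtain ⟨P, hP⟩ := hp
  obtain ⟨Q, hQ⟩ := hq
  exact ⟨P * Q, by simp [hP, hQ]⟩

theorem pow (hp : IsPolynomialFun p) (k : ℕ) : IsPolynomialFun fun x => p x ^ k := by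
  obtain ⟨P, hP⟩ := hp
  exact ⟨P ^ k, by simp [hP]⟩

theorem sum (s : Finset ι) {p : ι → (σ → ℝ) → ℝ} (hp : ∀ i, IsPolynomialFun (p i)) :
    IsPolynomialFun fun x => ∑ i ∈ s, p i x := by
  choose P hP using hp
  exact ⟨∑ i ∈ s, P i, by simp [hP]⟩

theorem isSemialgebraic_lt (hp : IsPolynomialFun p) (hq : IsPolynomialFun q) :
    IsSemialgebraic {x | p x < q x} := by
  obtain ⟨P, hP⟩ := hq.sub hp
  exact ⟨{_}, Set.finite_singleton _, fun _ hB => ⟨0, {P}, by simpa [hP] using hB⟩, by simp⟩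

theorem isSemialgebraic_le (hp : IsPolynomialFun p) (hq : IsPolynomialFun q) :
    IsSemialgebraic {x | p x ≤ q x} := by
  convert (hq.isSemialgebraic_lt hp).compl using 1
  ext x
  simp

theorem isSemialgebraic_eq (hp : IsPolynomialFun p) (hq : IsPolynomialFun q) :
    IsSemialgebraic {x | p x = q x} := by
  obtain ⟨P, hP⟩ := hp.sub hq
  convert isSemialgebraic_zeros P using 1
  ext x
  simp [hP, sub_eq_zero]

end IsPolynomialFun

/-! ## The squared Euclidean distance -/

section SqDist

variable {σ : Type*} [Fintype σ]

/-- The squared Euclidean distance. -/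
def sqDist (x y : σ → ℝ) : ℝ := ∑ i, (x i - y i) ^ 2

theorem IsPolynomialFun.sqDist {τ : Type*} {p q : σ → (τ → ℝ) → ℝ}
    (hp : ∀ i, IsPolynomialFun (p i)) (hq : ∀ i, IsPolynomialFun (q i)) :
    IsPolynomialFun fun x => Semialg.sqDist (fun i => p i x) (fun i => q i x) :=
  IsPolynomialFun.sum Finset.univ fun i => ((hp i).sub (hq i)).pow 2

theorem sqDist_nonneg (x y : σ → ℝ) : 0 ≤ sqDist x y :=
  Finset.sum_nonneg fun _ _ => sq_nonneg _

theorem sqDist_comm (x y : σ → ℝ) : sqDist x y = sqDist y x :=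
  Finset.sum_congr rfl fun _ _ => by ring

theorem sqDist_eq_zero {x y : σ → ℝ} : sqDist x y = 0 ↔ x = y := by
  simp [sqDist, Finset.sum_eq_zero_iff_of_nonneg, sq_nonneg, sub_eq_zero, funext_iff]

@[simp]
theorem sqDist_self (x : σ → ℝ) : sqDist x x = 0 := sqDist_eq_zero.2 rfl

/-- Coordinatewise this is `(a + b) ^ 2 ≤ 2 * a ^ 2 + 2 * b ^ 2`. The constant 2 is the price of a
distance that is polynomial. -/
theorem sqDist_triangle (x y z : σ → ℝ) : sqDist x z ≤ 2 * sqDist x y + 2 * sqDist y z := by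
  simp only [sqDist, Finset.mul_sum, ← Finset.sum_add_distrib]
  refine Finset.sum_le_sum fun i _ => ?_
  nlinarith [sq_nonneg ((x i - y i) - (y i - z i))]

theorem sqDist_continuous : Continuous fun v : (σ → ℝ) × (σ → ℝ) => sqDist v.1 v.2 := by
  unfold sqDist
  fun_prop

/-- The metric on `σ → ℝ` is the sup metric, so each coordinate difference is one term of the sum.
This is what allows semialgebraic Euclidean balls to serve as neighbourhoods. -/
theorem dist_sq_le_sqDist (x y : σ → ℝ) : dist x y ^ 2 ≤ sqDist x y := by
  rw [← Real.le_sqrt dist_nonneg (sqDist_nonneg x y), dist_pi_le_iff (Real.sqrt_nonneg _)]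
  intro i
  rw [Real.dist_eq]
  refine Real.abs_le_sqrt ?_
  exact Finset.single_le_sum (f := fun i => (x i - y i) ^ 2) (fun _ _ => sq_nonneg _)
    (Finset.mem_univ i)

theorem exists_sqDist_le_of_mem_nhds {x : σ → ℝ} {U : Set (σ → ℝ)} (hU : U ∈ nhds x) :
    ∃ r > 0, ∀ y, sqDist y x ≤ r → y ∈ U := by
  obtain ⟨ε, hε, h⟩ := Metric.mem_nhds_iff.1 hU
  refine ⟨(ε / 2) ^ 2, by positivity, fun y hy => h ?_⟩
  have := (sq_le_sq₀ dist_nonneg (by positivity)).1 ((dist_sq_le_sqDist y x).trans hy)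
  rw [Metric.mem_ball]
  linarith

end SqDist

/-! ## Extension of continuous functions from compact sets -/

open Topology in
/-- The Hausdorff extension formula: a continuous function `h` on a compact space that factors
through `ρ` extends continuously along `ρ`, by minimizing `h c * sqDist z (ρ c)`. -/
theorem exists_continuous_extension {σ K : Type*} [Fintype σ] [TopologicalSpace K] [CompactSpace K]
    [Nonempty K] {ρ : K → σ → ℝ} (hρ : Continuous ρ) {h : K → ℝ} (hh : Continuous h)
    (hfac : ∀ c c', ρ c = ρ c' → h c = h c') (hpos : ∀ c, 0 < h c)
    (hdbl : ∀ c c', h c ≤ 2 * h c') :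
    ∃ F : (σ → ℝ) → ℝ, Continuous F ∧ ∀ z t, F z = t ↔ (∃ c, ρ c = z ∧ h c = t) ∨
      ∃ c₀, 0 < sqDist z (ρ c₀) ∧
        (∀ c, sqDist z (ρ c₀) ≤ sqDist z (ρ c) ∧ t * sqDist z (ρ c₀) ≤ h c * sqDist z (ρ c)) ∧
        ∃ c₁, t * sqDist z (ρ c₀) = h c₁ * sqDist z (ρ c₁) := by
  classical
  have hcont : Continuous fun v : (σ → ℝ) × K => sqDist v.1 (ρ v.2) :=
    sqDist_continuous.comp (continuous_fst.prodMk (hρ.comp continuous_snd))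
  have hcont' : Continuous fun v : (σ → ℝ) × K => h v.2 * sqDist v.1 (ρ v.2) :=
    (hh.comp continuous_snd).mul hcont
  have hmin : ∀ (f : (σ → ℝ) → K → ℝ), Continuous (fun v : (σ → ℝ) × K => f v.1 v.2) →
      ∃ m : (σ → ℝ) → ℝ, Continuous m ∧ (∀ z c, m z ≤ f z c) ∧ ∀ z, ∃ c, f z c = m z := by
    intro f hf
    have key : ∀ z, ∃ c, IsLeast (f z '' Set.univ) (f z c) := by
      intro z
      obtain ⟨c, -, hc⟩ := isCompact_univ.exists_isMinOn (Set.univ_nonempty (α := K))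
        (f := f z) (hf.comp (Continuous.prodMk_right z)).continuousOn
      refine ⟨c, ⟨c, trivial, rfl⟩, ?_⟩
      rintro _ ⟨c', -, rfl⟩
      exact hc (Set.mem_univ c')
    -- The minimum over a compact parameter space depends continuously on `z`.
    refine ⟨_, isCompact_univ.continuous_sInf hf, fun z c => ?_, fun z => ?_⟩
    · obtain ⟨c₀, hc⟩ := key z
      rw [hc.csInf_eq]
      exact hc.2 ⟨c, trivial, rfl⟩
    · obtain ⟨c₀, hc⟩ := key z
      exact ⟨c₀, hc.csInf_eq.symm⟩
  obtain ⟨d, hd, hdle, hdex⟩ := hmin (fun z c => sqDist z (ρ c)) hcont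
  obtain ⟨m, hm, hmle, hmex⟩ := hmin (fun z c => h c * sqDist z (ρ c)) hcont'
  have hd0 : ∀ z, (∃ c, ρ c = z) ↔ d z = 0 := by
    intro z
    constructor
    · rintro ⟨c, rfl⟩
      refine le_antisymm ((hdle _ c).trans (by simp)) ?_
      obtain ⟨c', hc'⟩ := hdex (ρ c)
      exact hc' ▸ sqDist_nonneg _ _
    · intro h0
      obtain ⟨c', hc'⟩ := hdex z
      exact ⟨c', (sqDist_eq_zero.1 (hc'.trans h0)).symm⟩
  have hdnn : ∀ z, 0 ≤ d z := fun z => by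
    obtain ⟨c', hc'⟩ := hdex z
    exact hc' ▸ sqDist_nonneg _ _
  let F : (σ → ℝ) → ℝ := fun z => if hz : ∃ c, ρ c = z then h hz.choose else m z / d z
  have hF0 : ∀ c, F (ρ c) = h c := by
    intro c
    have hz : ∃ c', ρ c' = ρ c := ⟨c, rfl⟩
    simp only [F, dif_pos hz]
    exact hfac _ _ hz.choose_spec
  have hF1 : ∀ z, d z ≠ 0 → F z = m z / d z := by
    intro z hz
    simp only [F, dif_neg (mt (hd0 z).1 hz)]
  refine ⟨F, continuous_iff_continuousAt.2 fun z₀ => ?_, fun z t => ?_⟩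
  · by_cases hz₀ : d z₀ = 0
    swap
    · refine ((hm.continuousAt (x := z₀)).div hd.continuousAt hz₀).congr ?_
      filter_upwards [hd.continuousAt.eventually_ne hz₀] with z hz
      exact (hF1 z hz).symm
    obtain ⟨c₀, rfl⟩ := (hd0 z₀).2 hz₀
    rw [Metric.continuousAt_iff']
    intro ε hε
    rw [hF0]
    -- `h` is continuous as a function of `ρ c`: the compact set where `h` is at least `ε` away from
    -- `h c₀` has image at positive distance from `ρ c₀`, because `h` factors through `ρ`.
    obtain ⟨η, hη, hnear⟩ : ∃ η > 0, ∀ c, sqDist (ρ c₀) (ρ c) < η → |h c - h c₀| < ε := by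
      let B : Set K := {c | ε ≤ |h c - h c₀|}
      have hB : IsCompact B :=
        (isClosed_le continuous_const (hh.sub continuous_const).abs).isCompact
      rcases B.eq_empty_or_nonempty with hBe | hBn
      · refine ⟨1, one_pos, fun c _ => ?_⟩
        by_contra! hc
        have : c ∈ B := hc
        simp [hBe] at this
      · obtain ⟨b, hbB, hb⟩ := hB.exists_isMinOn hBn
          (hcont.comp (Continuous.prodMk_right (ρ c₀))).continuousOn
        refine ⟨sqDist (ρ c₀) (ρ b), (sqDist_nonneg _ _).lt_of_ne' fun h0 => ?_, fun c hc => ?_⟩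
        · have := hfac _ _ (sqDist_eq_zero.1 h0)
          have hbB' : ε ≤ |h b - h c₀| := hbB
          simp only [this, sub_self, abs_zero] at hbB'
          linarith
        · by_contra! hc'
          exact absurd (hb (show c ∈ B from hc')) (not_le.2 hc)
    -- Write `s` for `sqDist (ρ c₀) z`. With `6 * s < η`, the triangle inequality puts a nearest
    -- point of `z` within `η` of `ρ c₀`, and puts any point not within `η` of `ρ c₀` at squared
    -- distance at least `2 * s ≥ 2 * d z` from `z`.
    have hev : ∀ᶠ z in 𝓝 (ρ c₀), sqDist (ρ c₀) z < η / 6 :=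
      (sqDist_continuous.comp (Continuous.prodMk_right (ρ c₀))).continuousAt.eventually_lt
        continuousAt_const (by simpa using by positivity)
    filter_upwards [hev] with z hz
    rw [Real.dist_eq]
    by_cases hdz : d z = 0
    · obtain ⟨c, rfl⟩ := (hd0 z).2 hdz
      rw [hF0]
      exact hnear c (by linarith)
    have hdz' : 0 < d z := (hdnn z).lt_of_ne' hdz
    have hdz₀ : d z ≤ sqDist (ρ c₀) z := (hdle z c₀).trans (sqDist_comm _ _).le
    rw [hF1 z hdz, abs_sub_lt_iff]
    constructor
    · obtain ⟨c, hc⟩ := hdex z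
      have h1 := sqDist_triangle (ρ c₀) z (ρ c)
      have h2 := abs_sub_lt_iff.1 (hnear c (by linarith))
      have h3 : m z / d z ≤ h c := by
        rw [div_le_iff₀ hdz', ← hc]
        exact hmle z c
      linarith
    · obtain ⟨c, hc⟩ := hmex z
      have hle : h c₀ - ε < m z / d z := by
        rw [lt_div_iff₀ hdz', ← hc]
        have hc0 := hpos c
        by_cases hcn : sqDist (ρ c₀) (ρ c) < η
        · have h2 := abs_sub_lt_iff.1 (hnear c hcn)
          have h3 := mul_lt_mul_of_pos_right (show h c₀ - ε < h c by linarith) hdz'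
          have h4 := mul_le_mul_of_nonneg_left (hdle z c) hc0.le
          linarith
        -- A far minimizer costs at least `2 * h c * d z ≥ h c₀ * d z`; here the doubling hypothesis
        -- on `h` enters.
        · have h1 := sqDist_triangle (ρ c₀) z (ρ c)
          have h2 : 2 * d z ≤ sqDist z (ρ c) := by linarith
          have h3 := mul_le_mul_of_nonneg_left h2 hc0.le
          have h4 := mul_lt_mul_of_pos_right
            (show h c₀ - ε < 2 * h c by linarith [hdbl c₀ c]) hdz'
          linarith
      linarith
  · constructor
    · rintro rfl
      by_cases hdz : d z = 0
      · obtain ⟨c, rfl⟩ := (hd0 z).2 hdz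
        exact Or.inl ⟨c, rfl, (hF0 c).symm⟩
      · right
        obtain ⟨c₀, hc₀⟩ := hdex z
        obtain ⟨c₁, hc₁⟩ := hmex z
        refine ⟨c₀, hc₀ ▸ (hdnn z).lt_of_ne' hdz, fun c => ?_, c₁, ?_⟩
        · rw [hc₀, hF1 z hdz, div_mul_cancel₀ _ hdz]
          exact ⟨hdle z c, hmle z c⟩
        · rw [hc₀, hF1 z hdz, div_mul_cancel₀ _ hdz, hc₁]
    · rintro (⟨c, rfl, rfl⟩ | ⟨c₀, h0, h1, c₁, h2⟩)
      · exact hF0 c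
      · have e : sqDist z (ρ c₀) = d z := by
          obtain ⟨c, hc⟩ := hdex z
          exact le_antisymm (hc ▸ (h1 c).1) (hdle z c₀)
        rw [e] at h0 h1 h2
        rw [hF1 z h0.ne', div_eq_iff h0.ne']
        obtain ⟨c, hc⟩ := hmex z
        exact le_antisymm (h2 ▸ hmle z c₁) (hc ▸ (h1 c).2)

/-- A semialgebraic Tietze extension theorem for functions with values in `[a, 2a]`, given by a
compact graph. -/
theorem exists_semialgebraic_extension {σ : Type*} [Fintype σ] {A : Set (σ ⊕ Unit → ℝ)}
    (hA : IsSemialgebraic A) (hAc : IsCompact A) (hAne : A.Nonempty)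
    (hfac : ∀ v ∈ A, ∀ w ∈ A, (fun i => v (Sum.inl i)) = (fun i => w (Sum.inl i)) →
      v (Sum.inr ()) = w (Sum.inr ()))
    (hpos : ∀ v ∈ A, 0 < v (Sum.inr ()))
    (hdbl : ∀ v ∈ A, ∀ w ∈ A, v (Sum.inr ()) ≤ 2 * w (Sum.inr ())) :
    ∃ F : (σ → ℝ) → ℝ, Continuous F ∧
      IsSemialgebraic {v : σ ⊕ Unit → ℝ | F (fun i => v (Sum.inl i)) = v (Sum.inr ())} ∧
      ∀ v ∈ A, F (fun i => v (Sum.inl i)) = v (Sum.inr ()) := by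
  have := isCompact_iff_compactSpace.1 hAc
  have := hAne.to_subtype
  obtain ⟨F, hF, hgr⟩ := exists_continuous_extension (K := A)
    (ρ := fun v i => (v : σ ⊕ Unit → ℝ) (Sum.inl i)) (continuous_pi fun i => (continuous_apply (Sum.inl i)).comp continuous_subtype_val)
    (h := fun v => (v : σ ⊕ Unit → ℝ) (Sum.inr ()))
    ((continuous_apply (Sum.inr ())).comp continuous_subtype_val)
    (fun v w h => hfac v v.2 w w.2 h) (fun v => hpos v v.2) (fun v w => hdbl v v.2 w w.2)
  refine ⟨F, hF, ?_, fun v hv => (hgr _ _).2 (Or.inl ⟨⟨v, hv⟩, rfl, rfl⟩)⟩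
  -- The description `hgr` of the graph of `F`, with its quantifiers over the compact space turned
  -- into quantifiers over `A`. Its first alternative says just that the point lies in `A`.
  have key : IsSemialgebraic (A ∪ {v : σ ⊕ Unit → ℝ | ∃ v₀ : σ ⊕ Unit → ℝ, v₀ ∈ A ∧
      0 < sqDist (fun i => v (Sum.inl i)) (fun i => v₀ (Sum.inl i)) ∧
      (∀ w : σ ⊕ Unit → ℝ, w ∈ A →
        sqDist (fun i => v (Sum.inl i)) (fun i => v₀ (Sum.inl i)) ≤
          sqDist (fun i => v (Sum.inl i)) (fun i => w (Sum.inl i)) ∧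
        v (Sum.inr ()) * sqDist (fun i => v (Sum.inl i)) (fun i => v₀ (Sum.inl i)) ≤
          w (Sum.inr ()) * sqDist (fun i => v (Sum.inl i)) (fun i => w (Sum.inl i))) ∧
      ∃ w : σ ⊕ Unit → ℝ, w ∈ A ∧
        v (Sum.inr ()) * sqDist (fun i => v (Sum.inl i)) (fun i => v₀ (Sum.inl i)) =
          w (Sum.inr ()) * sqDist (fun i => v (Sum.inl i)) (fun i => w (Sum.inl i))}) := by
    have hc := fun {τ : Type _} (i : τ) => IsPolynomialFun.coord i
    refine hA.union (IsSemialgebraic.exists ((hA.reindex Sum.inr).inter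
      (((IsPolynomialFun.const 0).isSemialgebraic_lt
        (IsPolynomialFun.sqDist (fun _ => hc _) (fun _ => hc _))).inter
      (IsSemialgebraic.inter (IsSemialgebraic.forall ?_) (IsSemialgebraic.exists ?_)))))
    · exact (hA.reindex Sum.inr).imp (IsSemialgebraic.inter
        (IsPolynomialFun.isSemialgebraic_le
          (IsPolynomialFun.sqDist (fun _ => hc _) (fun _ => hc _))
          (IsPolynomialFun.sqDist (fun _ => hc _) (fun _ => hc _)))
        (IsPolynomialFun.isSemialgebraic_le
          ((hc _).mul (IsPolynomialFun.sqDist (fun _ => hc _) (fun _ => hc _)))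
          ((hc _).mul (IsPolynomialFun.sqDist (fun _ => hc _) (fun _ => hc _)))))
    · exact (hA.reindex Sum.inr).inter (IsPolynomialFun.isSemialgebraic_eq
          ((hc _).mul (IsPolynomialFun.sqDist (fun _ => hc _) (fun _ => hc _)))
          ((hc _).mul (IsPolynomialFun.sqDist (fun _ => hc _) (fun _ => hc _))))
  convert key using 1
  ext v
  simp only [Set.mem_ofPred_eq, Set.mem_union, hgr, Subtype.exists, Subtype.forall, exists_prop]
  refine or_congr ⟨?_, fun hv => ⟨v, hv, rfl, rfl⟩⟩ Iff.rfl
  rintro ⟨w, hw, h1, h2⟩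
  suffices w = v from this ▸ hw
  funext i
  rcases i with i | ⟨⟩
  · exact congrFun h1 i
  · exact h2

/-! ## Operations on semialgebraic functions -/

section Functions

variable {σ : Type*} {M : Set (σ → ℝ)}

/-- A continuous function that is related to a semialgebraic function by a semialgebraic relation
is semialgebraic. -/
theorem IsSemialgebraicFun.of_rel {f h : C(M, ℝ)} (hf : IsSemialgebraicFun f)
    {R : Set (Bool → ℝ)} (hR : IsSemialgebraic R)
    (hfh : ∀ x t, h x = t ↔ (fun b : Bool => if b then t else f x) ∈ R) :
    IsSemialgebraicFun h := by
  have h1 := hf.reindex (Sum.elim (fun i => Sum.inl (Sum.inl i)) (fun _ => Sum.inr ()) :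
    σ ⊕ Unit → (σ ⊕ Unit) ⊕ Unit)
  have h2 := hR.reindex (fun b : Bool => if b then Sum.inl (Sum.inr ()) else Sum.inr () :
    Bool → (σ ⊕ Unit) ⊕ Unit)
  unfold IsSemialgebraicFun
  convert (h1.inter h2).exists_sum using 1
  ext v
  simp only [mem_graph, Set.mem_inter_iff, Set.mem_ofPred_eq, Sum.elim_inl, Sum.elim_inr,
    forall_const]
  have e : ∀ y : Unit → ℝ, (fun b : Bool => Sum.elim v y (if b then Sum.inl (Sum.inr ()) else
      Sum.inr ())) = fun b : Bool => if b then v (Sum.inr ()) else y () := by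
    intro y
    funext b
    cases b <;> rfl
  simp only [e]
  constructor
  · rintro ⟨hM, hv⟩
    exact ⟨fun _ => f ⟨_, hM⟩, ⟨hM, rfl⟩, (hfh _ _).1 (hv ()).symm⟩
  · rintro ⟨y, ⟨hM, h1⟩, h2⟩
    exact ⟨hM, fun _ => ((hfh _ _).2 (h1 ▸ h2)).symm⟩

theorem IsPolynomialFun.isSemialgebraicFun (hM : IsSemialgebraic M) {p : (σ → ℝ) → ℝ}
    (hp : IsPolynomialFun p) {f : C(M, ℝ)} (hf : ∀ x : M, f x = p x) : IsSemialgebraicFun f := by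
  obtain ⟨P, hP⟩ := hp
  have h1 := hM.reindex (Sum.inl : σ → σ ⊕ Unit)
  have h2 := (IsPolynomialFun.coord (Sum.inr () : σ ⊕ Unit)).isSemialgebraic_eq
    (q := fun v => p fun i => v (Sum.inl i))
    ⟨MvPolynomial.rename Sum.inl P, fun v => by rw [MvPolynomial.eval_rename, hP]; rfl⟩
  unfold IsSemialgebraicFun
  convert h1.inter h2 using 1
  ext v
  simp only [mem_graph, hf, Set.mem_inter_iff, Set.mem_ofPred_eq, exists_prop]
  exact and_congr_right fun _ => ⟨fun h => h (), fun h _ => h⟩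

theorem IsSemialgebraicFun.inv {f h : C(M, ℝ)} (hf : IsSemialgebraicFun f) (h0 : ∀ x, f x ≠ 0)
    (hh : ∀ x, h x = (f x)⁻¹) : IsSemialgebraicFun h := by
  refine hf.of_rel (((IsPolynomialFun.coord true).mul
    (IsPolynomialFun.coord false)).isSemialgebraic_eq (IsPolynomialFun.const 1)) fun x t => ?_
  simp only [Set.mem_ofPred_eq, hh, if_true, Bool.false_eq_true, if_false]
  have := h0 x
  grind

theorem IsSemialgebraicFun.max_zero {f h : C(M, ℝ)} (hf : IsSemialgebraicFun f)
    (hh : ∀ x, h x = max 0 (f x)) : IsSemialgebraicFun h := by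
  have hc := fun b : Bool => IsPolynomialFun.coord b
  have h0 := IsPolynomialFun.const (σ := Bool) 0
  refine hf.of_rel ((((hc true).isSemialgebraic_eq (hc false)).inter
    (h0.isSemialgebraic_le (hc false))).union (((hc true).isSemialgebraic_eq h0).inter
    ((hc false).isSemialgebraic_le h0))) fun x t => ?_
  simp only [Set.mem_union, Set.mem_inter_iff, Set.mem_ofPred_eq, hh, if_true, Bool.false_eq_true,
    if_false]
  grind

/-- The polynomial relation `t ^ 3 = f x` determines `t`, since cubing is injective on the real
line. -/
theorem IsSemialgebraicFun.cbrt {f h : C(M, ℝ)} (hf : IsSemialgebraicFun f)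
    (hh : ∀ x, h x ^ 3 = f x) : IsSemialgebraicFun h := by
  refine hf.of_rel (((IsPolynomialFun.coord true).pow 3).isSemialgebraic_eq
    (IsPolynomialFun.coord false)) fun x t => ?_
  simp only [Set.mem_ofPred_eq, if_true, Bool.false_eq_true, if_false, ← hh]
  have hodd : Odd 3 := by decide
  exact ⟨fun h => by rw [h], fun h => (hodd.strictMono_pow.injective h).symm⟩

end Functions

/-- Every real number has a real cube root depending continuously on it. -/
theorem exists_continuous_cbrt : ∃ κ : ℝ → ℝ, Continuous κ ∧ ∀ x, κ x ^ 3 = x := by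
  have hodd : Odd 3 := by decide
  have hs : Function.Surjective fun x : ℝ => x ^ 3 := by
    refine (continuous_pow 3).surjective (Filter.tendsto_pow_atTop (by norm_num)) ?_
    refine Filter.tendsto_atBot_mono' _ ?_ Filter.tendsto_id
    filter_upwards [Filter.eventually_le_atBot (-1 : ℝ)] with x hx
    simp only [id]
    -- For `x ≤ -1` one has `x ^ 3 ≤ x`, because `-x * (x ^ 2 - 1)` is nonnegative.
    nlinarith [mul_nonneg (neg_nonneg.2 (show x ≤ 0 by linarith)) (show 0 ≤ x ^ 2 - 1 by nlinarith)]
  let e := StrictMono.orderIsoOfSurjective (fun x : ℝ => x ^ 3) hodd.strictMono_pow hs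
  exact ⟨e.symm, e.symm.continuous, fun x => e.apply_symm_apply x⟩

/-- A semialgebraic function factors through `π` on a closed set on which `π` is injective. -/
theorem exists_factorization {σ τ : Type*} [Fintype σ] [Fintype τ] {M : Set (σ → ℝ)}
    {N : Set (τ → ℝ)} (hN : IsSemialgebraic N) (hMc : IsCompact M) {π : M → N}
    (hπ : IsSemialgebraicMap π) {C : Set (σ → ℝ)} (hC : IsSemialgebraic C) (hCc : IsClosed C)
    (hinj : Set.InjOn π {x : M | (x : σ → ℝ) ∈ C}) {f : C(M, ℝ)} (hf : IsSemialgebraicFun f) :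
    ∃ g : C(N, ℝ), IsSemialgebraicFun g ∧ ∀ x : M, (x : σ → ℝ) ∈ C → g (π x) = f x := by
  have := isCompact_iff_compactSpace.1 hMc
  -- `M` is the projection of the graph of `f`.
  have hM : IsSemialgebraic M := by
    convert (show IsSemialgebraic (graph fun (x : M) (_ : Unit) => f x) from hf).exists_sum using 1
    ext x
    simp only [mem_graph, Set.mem_ofPred_eq, Sum.elim_inl, Sum.elim_inr]
    exact ⟨fun hx => ⟨fun _ => f ⟨x, hx⟩, hx, fun _ => rfl⟩, fun ⟨_, hx, _⟩ => hx⟩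
  obtain ⟨B, hB⟩ := isCompact_univ.exists_bound_of_continuousOn f.continuous.continuousOn
  -- The bound `B` might be negative when `M` is empty.
  replace hB : ∀ x, |f x| ≤ |B| := fun x => (hB x (Set.mem_univ x)).trans (le_abs_self B)
  -- The shifted function `f + b` takes values between `2 * |B| + 1` and `4 * |B| + 1`, so it is
  -- positive and any two values differ by a factor of at most 2. The shift is undone at the end.
  set b := 3 * |B| + 1
  have hfb : IsSemialgebraicFun (f + ContinuousMap.const M b) :=
    hf.binop (isSemialgebraicFun_const hM b) (· + ·) (fun _ => rfl)
      (MvPolynomial.X false + MvPolynomial.X true) (by simp)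
  let Φ : M → τ ⊕ Unit → ℝ := fun x => Sum.elim (π x : τ → ℝ) fun _ => f x + b
  have hΦ : Continuous Φ := by
    refine continuous_pi fun i => ?_
    rcases i with i | i
    · exact (continuous_apply i).comp (continuous_subtype_val.comp hπ.1)
    · exact f.continuous.add continuous_const
  have hK : IsCompact {x : M | (x : σ → ℝ) ∈ C} :=
    (hCc.preimage continuous_subtype_val).isCompact
  -- This image is the graph, over `π(C ∩ M)`, of the shifted function induced by `f`: it arises by
  -- eliminating `x` from the graphs of `π` and `f + b` and the condition `x ∈ C`.
  have hA : IsSemialgebraic (Φ '' {x : M | (x : σ → ℝ) ∈ C}) := by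
    have h1 := hπ.2.reindex (Sum.elim (fun i => Sum.inr i) (fun j => Sum.inl (Sum.inl j)) :
      σ ⊕ τ → (τ ⊕ Unit) ⊕ σ)
    have h2 := hfb.reindex (Sum.elim (fun i => Sum.inr i) (fun _ => Sum.inl (Sum.inr ())) :
      σ ⊕ Unit → (τ ⊕ Unit) ⊕ σ)
    convert ((h1.inter h2).inter (hC.reindex Sum.inr)).exists_sum using 1
    ext v
    simp only [mem_graph, Set.mem_inter_iff, Set.mem_ofPred_eq, Sum.elim_inl, Sum.elim_inr,
      forall_const]
    constructor
    · rintro ⟨x, hx, rfl⟩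
      exact ⟨x, ⟨⟨x.2, fun _ => rfl⟩, ⟨x.2, rfl⟩⟩, hx⟩
    · rintro ⟨x, ⟨⟨hx, h1⟩, ⟨_, h2⟩⟩, hxC⟩
      refine ⟨⟨x, hx⟩, hxC, ?_⟩
      funext i
      rcases i with i | ⟨⟩
      · exact (h1 i).symm
      · exact h2.symm
  rcases Set.eq_empty_or_nonempty {x : M | (x : σ → ℝ) ∈ C} with he | hne
  · refine ⟨_, isSemialgebraicFun_const hN 0, fun x hx => ?_⟩
    have : x ∈ {x : M | (x : σ → ℝ) ∈ C} := hx
    simp [he] at this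
  obtain ⟨F, hF, hFs, hFA⟩ := exists_semialgebraic_extension hA (hK.image hΦ) (hne.image Φ)
    (by
      rintro _ ⟨x, hx, rfl⟩ _ ⟨y, hy, rfl⟩ h
      have : x = y := hinj hx hy (Subtype.ext h)
      rw [this])
    (by
      rintro _ ⟨x, hx, rfl⟩
      have := abs_le.1 (hB x)
      have := abs_nonneg B
      simp only [Φ, Sum.elim_inr, b]
      linarith)
    (by
      rintro _ ⟨x, hx, rfl⟩ _ ⟨y, hy, rfl⟩
      have := abs_le.1 (hB x)
      have := abs_le.1 (hB y)
      simp only [Φ, Sum.elim_inr, b]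
      linarith)
  let G : C(N, ℝ) := ⟨fun z => F z, hF.comp continuous_subtype_val⟩
  have hG : IsSemialgebraicFun G := by
    unfold IsSemialgebraicFun
    convert (hN.reindex (Sum.inl : τ → τ ⊕ Unit)).inter hFs using 1
    ext v
    simp only [mem_graph, Set.mem_inter_iff, Set.mem_ofPred_eq, exists_prop,
      ContinuousMap.coe_mk, G]
    exact and_congr_right fun _ => ⟨fun h => (h ()).symm, fun h _ => h.symm⟩
  refine ⟨G - ContinuousMap.const N b, hG.binop (isSemialgebraicFun_const hN b) (· - ·)
    (fun _ => rfl) (MvPolynomial.X false - MvPolynomial.X true) (by simp), fun x hx => ?_⟩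
  have := hFA (Φ x) ⟨x, hx, rfl⟩
  simp only [Φ, Sum.elim_inl, Sum.elim_inr] at this
  simp [G, this]

/-! ### Finiteness of the induced homomorphism and local injectivity -/

section Main

variable {σ τ : Type*} {M : Set (σ → ℝ)} {N : Set (τ → ℝ)}
  {π : M → N}

theorem inducedHom_finite_of_generators [Finite τ] (hM : IsSemialgebraic M)
    (hN : IsSemialgebraic N) (hπ : IsSemialgebraicMap π)
    {ι : Type*} [Finite ι] (b : ι → C(M, ℝ))
    (hb : ∀ i, IsSemialgebraicFun (b i))
    (h : ∀ f : C(M, ℝ), IsSemialgebraicFun f → ∃ g : ι → C(N, ℝ), (∀ i, IsSemialgebraicFun (g i)) ∧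
      ∀ x, f x = ∑ᶠ i, g i (π x) * b i x) :
    (inducedHom hM hN π hπ).Finite := by
  have := Fintype.ofFinite ι
  let φ := (inducedHom hM hN π hπ).toRingHom
  let := φ.toAlgebra
  let B : ι → semialgebraicFunctions hM := fun i => ⟨b i, hb i⟩
  change Module.Finite (semialgebraicFunctions hN) (semialgebraicFunctions hM)
  refine ⟨(Submodule.fg_def).2 ⟨Set.range B, Set.finite_range B, ?_⟩⟩
  refine eq_top_iff.2 fun f _ => (Submodule.mem_span_range_iff_exists_fun _).2 ?_
  obtain ⟨g, hg, e⟩ := h f f.2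
  refine ⟨fun i => ⟨g i, hg i⟩, Subtype.ext (ContinuousMap.ext fun x => ?_)⟩
  rw [e, finsum_eq_sum_of_fintype, AddSubmonoidClass.coe_finsetSum, ContinuousMap.sum_apply]
  rfl

/-- Only the continuity of the coefficients is kept: the converse direction uses nothing about them
but a bound on a compact `N`. -/
theorem exists_generators_of_inducedHom_finite [Finite τ] (hM : IsSemialgebraic M)
    (hN : IsSemialgebraic N) (hπ : IsSemialgebraicMap π)
    (h : (inducedHom hM hN π hπ).Finite) :
    ∃ (r : ℕ) (b : Fin r → C(M, ℝ)), (∀ i, IsSemialgebraicFun (b i)) ∧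
      ∀ f : C(M, ℝ), IsSemialgebraicFun f → ∃ g : Fin r → C(N, ℝ),
        ∀ x, f x = ∑ i, g i (π x) * b i x := by
  let φ := (inducedHom hM hN π hπ).toRingHom
  let := φ.toAlgebra
  have : Module.Finite (semialgebraicFunctions hN) (semialgebraicFunctions hM) := h
  obtain ⟨r, B, hB⟩ := Module.Finite.exists_fin (R := semialgebraicFunctions hN)
    (M := semialgebraicFunctions hM)
  refine ⟨r, fun i => B i, fun i => (B i).2, fun f hf => ?_⟩
  have hmem : (⟨f, hf⟩ : semialgebraicFunctions hM) ∈
      Submodule.span (semialgebraicFunctions hN) (Set.range B) := hB ▸ Submodule.mem_top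
  obtain ⟨c, hc⟩ := (Submodule.mem_span_range_iff_exists_fun _).1 hmem
  refine ⟨fun i => c i, fun x => ?_⟩
  have e := congrArg (fun F : semialgebraicFunctions hM => (F : C(M, ℝ)) x) hc
  simp only [AddSubmonoidClass.coe_finsetSum, ContinuousMap.sum_apply] at e
  exact e.symm

theorem inducedHom_finite_of_locallyInjective [Fintype σ] [Fintype τ] (hM : IsSemialgebraic M)
    (hN : IsSemialgebraic N) (hπ : IsSemialgebraicMap π)
    (hMc : IsCompact M) (h : LocallyInjective π) :
    (inducedHom hM hN π hπ).Finite := by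
  have := isCompact_iff_compactSpace.1 hMc
  obtain ⟨𝓤, h𝓤, hcov⟩ := h
  -- Each member of the cover is replaced by closed balls, which are closed and semialgebraic, as
  -- `exists_factorization` requires.
  have hloc : ∀ x : M, ∃ r > 0, Set.InjOn π {y : M | sqDist (y : σ → ℝ) x ≤ r} := by
    intro x
    obtain ⟨U, hU, hxU⟩ := Set.mem_sUnion.1 (hcov ▸ Set.mem_univ x)
    obtain ⟨hUo, -, hinj⟩ := h𝓤 U hU
    obtain ⟨V, hV, hVU⟩ := mem_nhds_subtype _ _ _ |>.1 (hUo.mem_nhds hxU)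
    obtain ⟨r, hr, hrV⟩ := exists_sqDist_le_of_mem_nhds hV
    exact ⟨r, hr, hinj.mono fun y hy => hVU (hrV _ hy)⟩
  choose r hr hinj using hloc
  have hD : ∀ x : M, Continuous fun y : M => r x - sqDist (y : σ → ℝ) x := fun x =>
    continuous_const.sub (sqDist_continuous.comp (continuous_subtype_val.prodMk continuous_const))
  have hDp : ∀ x : M, IsPolynomialFun fun y : σ → ℝ => sqDist y x := fun x =>
    IsPolynomialFun.sqDist (fun _ => .coord _) fun _ => .const _
  obtain ⟨t, ht⟩ := CompactSpace.elim_nhds_subcover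
    (fun x : M => {y : M | 0 < r x - sqDist (y : σ → ℝ) x})
    (fun x => (isOpen_lt continuous_const (hD x)).mem_nhds (by simpa using hr x))
  let θ : M → C(M, ℝ) := fun x => ⟨fun y => max 0 (r x - sqDist (y : σ → ℝ) x),
    continuous_const.max (hD x)⟩
  have hθ : ∀ x, θ x ∈ semialgebraicFunctions hM := fun x =>
    IsSemialgebraicFun.max_zero (f := ⟨_, hD x⟩)
      (((IsPolynomialFun.const _).sub (hDp x)).isSemialgebraicFun hM fun _ => rfl) fun _ => rfl
  have hθ0 : ∀ x y, 0 ≤ θ x y := fun x y => le_max_left _ _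
  let Θ : C(M, ℝ) := ∑ x ∈ t, θ x
  have hΘ : Θ ∈ semialgebraicFunctions hM := sum_mem fun x _ => hθ x
  have hΘ0 : ∀ y, 0 < Θ y := by
    intro y
    have hy : y ∈ ⋃ x ∈ t, {y : M | 0 < r x - sqDist (y : σ → ℝ) x} := ht ▸ trivial
    simp only [Set.mem_iUnion] at hy
    obtain ⟨x, hx, hxy⟩ := hy
    rw [ContinuousMap.sum_apply]
    exact Finset.sum_pos' (fun x _ => hθ0 x y) ⟨x, hx, lt_max_of_lt_right hxy⟩
  let Θi : C(M, ℝ) := ⟨fun y => (Θ y)⁻¹, Θ.continuous.inv₀ fun y => (hΘ0 y).ne'⟩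
  have hΘi : Θi ∈ semialgebraicFunctions hM :=
    IsSemialgebraicFun.inv (f := Θ) hΘ (fun y => (hΘ0 y).ne') fun _ => rfl
  refine inducedHom_finite_of_generators hM hN hπ (fun x : t => θ x) (fun x => hθ x)
    fun f hf => ?_
  -- Factoring `f / Θ` instead of `f` spares normalizing the generators `θ x`.
  have hq : f * Θi ∈ semialgebraicFunctions hM := mul_mem (show f ∈ _ from hf) hΘi
  have hfac := fun x : t => exists_factorization hN hMc hπ
    ((hDp x).isSemialgebraic_le (IsPolynomialFun.const (r x)))
    (isClosed_le (sqDist_continuous.comp (continuous_id.prodMk continuous_const))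
      continuous_const) (hinj x) hq
  choose g hg hgf using hfac
  refine ⟨g, hg, fun y => ?_⟩
  -- Off the closed ball the factorization says nothing, but there `θ x` vanishes.
  have hterm : ∀ x : t, g x (π y) * θ x y = (f y * (Θ y)⁻¹) * θ x y := by
    intro x
    by_cases hy : sqDist (y : σ → ℝ) x ≤ r x
    · rw [hgf x y hy]
      rfl
    · have : θ x y = 0 := max_eq_left (by linarith)
      rw [this, mul_zero, mul_zero]
  rw [finsum_congr hterm, finsum_eq_sum_of_fintype, ← Finset.mul_sum,
    Finset.sum_coe_sort t (fun x => θ x y), ← ContinuousMap.sum_apply]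
  exact (inv_mul_cancel_right₀ (hΘ0 y).ne' _).symm

open Topology in
-- With `Δ` the total difference of the generators over a pair in one fibre, the cube roots yield `Δ
-- ≤ Q * Δ`, where `Q` is continuous and vanishes at `(x₀, x₀)`. Near that point `Q < 1`, which
-- forces `Δ = 0`.
theorem eventually_injective_of_generators (hM : IsSemialgebraic M) (hNc : IsCompact N) {r : ℕ}
    {b : Fin r → C(M, ℝ)} (hb : ∀ i, IsSemialgebraicFun (b i))
    (h : ∀ f : C(M, ℝ), IsSemialgebraicFun f → ∃ g : Fin r → C(N, ℝ),
        ∀ x, f x = ∑ i, g i (π x) * b i x) (x₀ : M) :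
    ∀ᶠ p : M × M in 𝓝 (x₀, x₀), π p.1 = π p.2 → p.1 = p.2 := by
  have := isCompact_iff_compactSpace.1 hNc
  obtain ⟨κ, hκ, hκ3⟩ := exists_continuous_cbrt
  have hκ0 : κ 0 = 0 := pow_eq_zero_iff (n := 3) (by norm_num) |>.1 (hκ3 0)
  let f : Fin r → C(M, ℝ) := fun i => ⟨fun x => κ (b i x - b i x₀), by fun_prop⟩
  have hf3 : ∀ i x, f i x ^ 3 = b i x - b i x₀ := fun i x => hκ3 _
  have hf0 : ∀ i, f i x₀ = 0 := fun i => by simp [f, hκ0]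
  have hf : ∀ i, IsSemialgebraicFun (f i) := fun i =>
    IsSemialgebraicFun.cbrt (f := b i - ContinuousMap.const M (b i x₀))
      ((hb i).binop (isSemialgebraicFun_const hM _) (· - ·) (fun _ => rfl)
        (MvPolynomial.X false - MvPolynomial.X true) (by simp)) (hf3 i)
  choose g hg using fun i => h (f i) (hf i)
  let Δ : M × M → ℝ := fun p => ∑ j, |b j p.1 - b j p.2|
  let Q : M × M → ℝ := fun p => ∑ i, (∑ j, ‖g i j‖) *
    |f i p.1 ^ 2 + f i p.1 * f i p.2 + f i p.2 ^ 2|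
  have hQ : Continuous Q := by fun_prop
  have hQ0 : Q (x₀, x₀) = 0 := by simp [Q, hf0]
  filter_upwards [hQ.continuousAt.eventually_lt (continuousAt_const (y := (1 : ℝ)))
    (by rw [hQ0]; exact one_pos)] with p hp hπp
  have hfd : ∀ i, |f i p.1 - f i p.2| ≤ (∑ j, ‖g i j‖) * Δ p := by
    intro i
    -- The coefficients take the same value at both points because `π p.1 = π p.2`.
    have e : f i p.1 - f i p.2 = ∑ j, g i j (π p.2) * (b j p.1 - b j p.2) := by
      rw [hg i p.1, hg i p.2, hπp, ← Finset.sum_sub_distrib]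
      exact Finset.sum_congr rfl fun j _ => by ring
    rw [e, Finset.sum_mul]
    refine (Finset.abs_sum_le_sum_abs _ _).trans (Finset.sum_le_sum fun j _ => ?_)
    rw [abs_mul]
    exact mul_le_mul ((g i j).norm_coe_le_norm (π p.2))
      (Finset.single_le_sum (f := fun j => |b j p.1 - b j p.2|) (fun _ _ => abs_nonneg _)
        (Finset.mem_univ j)) (abs_nonneg _) (norm_nonneg _)
  have hΔ : Δ p ≤ Q p * Δ p := by
    rw [Finset.sum_mul]
    refine Finset.sum_le_sum fun i _ => ?_
    have e : b i p.1 - b i p.2 =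
        (f i p.1 - f i p.2) * (f i p.1 ^ 2 + f i p.1 * f i p.2 + f i p.2 ^ 2) := by
      have h1 := hf3 i p.1
      have h2 := hf3 i p.2
      linear_combination h2 - h1
    rw [e, abs_mul, mul_right_comm]
    exact mul_le_mul_of_nonneg_right (hfd i) (abs_nonneg _)
  have hΔ0 : Δ p = 0 := by
    have : 0 ≤ Δ p := Finset.sum_nonneg fun _ _ => abs_nonneg _
    nlinarith
  have hbp : ∀ j, b j p.1 = b j p.2 := fun j => sub_eq_zero.1 (abs_eq_zero.1
    ((Finset.sum_eq_zero_iff_of_nonneg fun _ _ => abs_nonneg _).1 hΔ0 j (Finset.mem_univ j)))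
  refine Subtype.ext (funext fun k => ?_)
  -- The coordinate functions are combinations of the generators over `N`, so the generators
  -- separate the points of each fibre.
  obtain ⟨c, hc⟩ := h ⟨fun x : M => (x : σ → ℝ) k,
    (continuous_apply k).comp continuous_subtype_val⟩
    ((IsPolynomialFun.coord k).isSemialgebraicFun hM fun _ => rfl)
  exact (hc p.1).trans (by simp only [hπp, hbp]; exact (hc p.2).symm)

theorem locallyInjective_of_inducedHom_finite [Fintype σ] [Finite τ] (hM : IsSemialgebraic M)
    (hN : IsSemialgebraic N) (hπ : IsSemialgebraicMap π)
    (hNc : IsCompact N)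
    (h : (inducedHom hM hN π hπ).Finite) : LocallyInjective π := by
  obtain ⟨r, b, hb, hgen⟩ := exists_generators_of_inducedHom_finite hM hN hπ h
  refine ⟨{U | IsOpen U ∧ IsSemialgebraic ((↑) '' U : Set (σ → ℝ)) ∧ Set.InjOn π U},
    fun _ hU => hU.out, Set.eq_univ_of_forall fun x₀ => ?_⟩
  have hev := eventually_injective_of_generators hM hNc hb hgen x₀
  -- A neighbourhood of the diagonal point contains a square `P ×ˢ P`, and `π` is injective on `P`;
  -- a ball inside `P` is open and semialgebraic.
  rw [nhds_prod_eq, Filter.Eventually, Filter.mem_prod_same_iff] at hev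
  obtain ⟨P, hP, hinj⟩ := hev
  obtain ⟨V, hV, hVP⟩ := mem_nhds_subtype _ _ _ |>.1 hP
  obtain ⟨ε, hε, hεV⟩ := exists_sqDist_le_of_mem_nhds hV
  refine ⟨{x : M | sqDist (x : σ → ℝ) x₀ < ε}, ⟨?_, ?_, ?_⟩, by simpa using hε⟩
  · exact isOpen_lt (sqDist_continuous.comp (continuous_subtype_val.prodMk continuous_const))
      continuous_const
  · convert hM.inter ((IsPolynomialFun.sqDist (fun i => .coord i)
      (fun i => .const ((x₀ : σ → ℝ) i))).isSemialgebraic_lt (.const ε)) using 1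
    ext x
    simp [and_comm]
  · exact fun x hx y hy => hinj (Set.mk_mem_prod (hVP (hεV x (le_of_lt hx)))
      (hVP (hεV y (le_of_lt hy))))

end Main

end Semialg

theorem mainTheorem2 {m n : ℕ} (M : Set (Fin m → ℝ)) (N : Set (Fin n → ℝ))
    (hM : Semialg.IsSemialgebraic M) (hN : Semialg.IsSemialgebraic N)
    (hMc : IsCompact M) (hNc : IsCompact N)
    (π : M → N) (hπ : Semialg.IsSemialgebraicMap π) :
    Semialg.LocallyInjective π ↔ (Semialg.inducedHom hM hN π hπ).Finite :=
  ⟨Semialg.inducedHom_finite_of_locallyInjective hM hN hπ hMc,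
    Semialg.locallyInjective_of_inducedHom_finite hM hN hπ hNc⟩
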